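/- **Theorem (streaming Slepian–Wolf coding, universal decoding).** Let $\mathcal X,\mathcal Y$ be finite non-empty alphabets and $(R_x,R_y)$ a pair of real rates, in bits per source symbol. All logarithms, entropies $H$ and divergences $D$ are to base 2, $|z|^+=\max(z,0)$, and an empty segment has entropy $0$. *Codes.* A randomized sequential encoder–decoder triplet of rate $(R_x,R_y)$ uses common randomness, shared by the encoders and the decoder and independent of the sources. At each time $j=1,2,\dots$ the $x$-encoder maps $x^j=(x_1,\dots,x_j)$ to $\lfloor jR_x\rfloor-\lfloor (j-1)R_x\rfloor$ bits (that is, to $R_x$ bits if $R_x$ is an integer; no bits are sent at a rate $\le 0$), and the $y$-encoder does the same with $y^j$ and $R_y$. At each time $n$ the decoder maps the two bit streams received up to time $n$ to estimates $(\hat x^{n},\hat y^{n})\in\mathcal X^n\times\mathcal Y^n$. The code is a *causal random binning* if all bits assigned to all prefixes $x^j$ and $y^j$, at all times, are i.i.d. Bernoulli(1/2). Let $B_x\subseteq\mathcal X^n$ and $B_y\subseteq\mathcal Y^n$ be the sets of sequences whose encodings agree with the two received streams. *Weighted suffix entropy decoder.* Let $x_a^b=(x_a,\dots,x_b)$ and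 let $H(\cdot)$, $H(\cdot|\cdot)$ of sequences denote the entropy and conditional entropy of their joint type (joint empirical distribution). For $1\le l,k\le n+1$, not both equal to $n+1$, put $$H_S(l,k,x^n,y^n)=\begin{cases}\frac{k-l}{n+1-l}H(x_l^{k-1}|y_l^{k-1})+\frac{n+1-k}{n+1-l}H(x_k^n,y_k^n),& l\le k,\\[2pt] \frac{l-k}{n+1-k}H(y_k^{l-1}|x_k^{l-1})+\frac{n+1-l}{n+1-k}H(x_l^n,y_l^n),& l> k.\end{cases}$$ Let $\mathcal F_n(l,k,x^n,y^n)$ be the set of pairs $(\tilde x^n,\tilde y^n)$ such that $\tilde x^n$ first differs from $x^n$ at time $l$ and $\tilde y^n$ first differs from $y^n$ at time $k$ (the value $n+1$ meaning that the sequences are equal). Let $i_x(x^n,y^n)$ be the largest $i\le n$ such that $H_S(l,k,x^n,y^n)<H_S(l,k,\tilde x^n,\tilde y^n)$ for all $l\le i$, all $k\le n+1$ and all $(\tilde x^n,\tilde y^n)\in (B_x\times B_y)\cap\mathcal F_n(l,k,x^n,y^n)$; define $i_y$ in the same way, with all $k\le i$ and all $l\le n+1$. The decoder chooses for $\hat x^n$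 the $x$-component of some pair in $B_x\times B_y$ that maximizes $i_x$, and for $\hat y^n$ the $y$-component of some pair in $B_x\times B_y$ that maximizes $i_y$; ties are broken arbitrarily. *Exponents.* For a distribution $p_{xy}$ on $\mathcal X\times\mathcal Y$ and $\gamma\in[0,1]$ let $$E_x^{UN}(\gamma)=\inf_{\tilde x,\tilde y,\bar x,\bar y}\ \gamma D(p_{\tilde x\tilde y}\|p_{xy})+(1-\gamma)D(p_{\bar x\bar y}\|p_{xy})+\big|\gamma[R_x-H(\tilde x|\tilde y)]+(1-\gamma)[R_x+R_y-H(\bar x,\bar y)]\big|^+,$$ $$E_y^{UN}(\gamma)=\inf_{\tilde x,\tilde y,\bar x,\bar y}\ \gamma D(p_{\tilde x\tilde y}\|p_{xy})+(1-\gamma)D(p_{\bar x\bar y}\|p_{xy})+\big|\gamma[R_y-H(\tilde y|\tilde x)]+(1-\gamma)[R_x+R_y-H(\bar x,\bar y)]\big|^+,$$ the infima being over all pairs of joint distributions $p_{\tilde x\tilde y},p_{\bar x\bar y}$ on $\mathcal X\times\mathcal Y$, with $0\cdot\infty=0$. With $\frac1{1-\gamma}=\infty$ at $\gamma=1$, put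 $$E_{SW,x}=\min\Big\{\inf_{\gamma\in[0,1]}E_x^{UN}(\gamma),\ \inf_{\gamma\in[0,1]}\tfrac1{1-\gamma}E_y^{UN}(\gamma)\Big\},\qquad E_{SW,y}=\min\Big\{\inf_{\gamma\in[0,1]}\tfrac1{1-\gamma}E_x^{UN}(\gamma),\ \inf_{\gamma\in[0,1]}E_y^{UN}(\gamma)\Big\},$$ $$E_{SW,xy}=\min\Big\{\inf_{\gamma\in[0,1]}E_x^{UN}(\gamma),\ \inf_{\gamma\in[0,1]}E_y^{UN}(\gamma)\Big\}.$$ *Claim.* There is a randomized sequential encoder–decoder triplet of rate $(R_x,R_y)$, whose encoders form a causal random binning and whose decoder is a weighted suffix entropy decoder, with the following property. It does not depend on the source distribution, and for every $p_{xy}$ on $\mathcal X\times\mathcal Y$ with $R_x>H(x|y)$, $R_y>H(y|x)$ and $R_x+R_y>H(x,y)$, if the pairs $(x_i,y_i)$ are i.i.d. with law $p_{xy}$, then (i) for all $E<E_{SW,x}$ there is $K>0$ such that $\Pr[\hat x^{n-\Delta}\ne x^{n-\Delta}]\le K\,2^{-\Delta E}$ for all integers $n,\Delta\ge0$; (ii)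 for all $E<E_{SW,y}$ there is $K>0$ such that $\Pr[\hat y^{n-\Delta}\ne y^{n-\Delta}]\le K\,2^{-\Delta E}$ for all integers $n,\Delta\ge0$; (iii) for all $E<E_{SW,xy}$ there is $K>0$ such that $\Pr[(\hat x^{n-\Delta},\hat y^{n-\Delta})\ne(x^{n-\Delta},y^{n-\Delta})]\le K\,2^{-\Delta E}$ for all integers $n,\Delta\ge0$. Here $\hat x^{n-\Delta},\hat y^{n-\Delta}$ are the first $n-\Delta$ symbols of the estimates made at time $n$ (empty if $\Delta\ge n$), and the probabilities are over the sources and the common randomness. -/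

import Mathlib

open MeasureTheory ProbabilityTheory
open scoped ENNReal

noncomputable section

namespace StreamingSW

universe u v

/-! ### Information measures on finite alphabets (all logarithms are to base 2) -/

/-- Shannon entropy, in bits, of a distribution `q` on a finite set. -/
def entropy {A : Type*} [Fintype A] (q : A → ℝ) : ℝ :=
  -∑ a, q a * Real.logb 2 (q a)

/-- The conditional entropy `H(a | b)`, in bits, when `(a, b)` has joint distribution `q`. -/
def condEntropy {A B : Type*} [Fintype A] [Fintype B] (q : A × B → ℝ) : ℝ :=
  -∑ a, ∑ b, q (a, b) * Real.logb 2 (q (a, b) / ∑ a', q (a', b))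

/-- The distribution of the pair `(b, a)` when `(a, b)` has distribution `q`. -/
def swapped {A B : Type*} (q : A × B → ℝ) : B × A → ℝ := fun z => q (z.2, z.1)

open Classical in
/-- The Kullback-Leibler divergence `D(q ‖ p)`, in bits; it is infinite unless `q ≪ p`. -/
def kl {A : Type*} [Fintype A] (q p : A → ℝ) : ℝ≥0∞ :=
  if ∀ a, p a = 0 → q a = 0 then ENNReal.ofReal (∑ a, q a * Real.logb 2 (q a / p a)) else ⊤

/-! ### The error exponents

`ENNReal.ofReal z` is the positive part of `z`. In the infima with the factor `1 / (1 - γ)` the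
inverse is taken in `[0, ∞]`, so that this factor is `∞` at `γ = 1`. -/

section Exponents

variable {X : Type u} {Y : Type v} [Fintype X] [Fintype Y]

def expX (p : X × Y → ℝ) (Rx Ry γ : ℝ) : ℝ≥0∞ :=
  ⨅ q ∈ stdSimplex ℝ (X × Y), ⨅ r ∈ stdSimplex ℝ (X × Y),
    ENNReal.ofReal γ * kl q p + ENNReal.ofReal (1 - γ) * kl r p
      + ENNReal.ofReal (γ * (Rx - condEntropy q) + (1 - γ) * (Rx + Ry - entropy r))

def expY (p : X × Y → ℝ) (Rx Ry γ : ℝ) : ℝ≥0∞ :=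
  ⨅ q ∈ stdSimplex ℝ (X × Y), ⨅ r ∈ stdSimplex ℝ (X × Y),
    ENNReal.ofReal γ * kl q p + ENNReal.ofReal (1 - γ) * kl r p
      + ENNReal.ofReal (γ * (Ry - condEntropy (swapped q)) + (1 - γ) * (Rx + Ry - entropy r))

/-- The exponent for errors in the `x`-stream. -/
def expSWX (p : X × Y → ℝ) (Rx Ry : ℝ) : ℝ≥0∞ :=
  min (⨅ γ ∈ Set.Icc (0 : ℝ) 1, expX p Rx Ry γ)
    (⨅ γ ∈ Set.Icc (0 : ℝ) 1, (ENNReal.ofReal (1 - γ))⁻¹ * expY p Rx Ry γ)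

/-- The exponent for errors in the `y`-stream. -/
def expSWY (p : X × Y → ℝ) (Rx Ry : ℝ) : ℝ≥0∞ :=
  min (⨅ γ ∈ Set.Icc (0 : ℝ) 1, (ENNReal.ofReal (1 - γ))⁻¹ * expX p Rx Ry γ)
    (⨅ γ ∈ Set.Icc (0 : ℝ) 1, expY p Rx Ry γ)

/-- The exponent for joint errors. -/
def expSWXY (p : X × Y → ℝ) (Rx Ry : ℝ) : ℝ≥0∞ :=
  min (⨅ γ ∈ Set.Icc (0 : ℝ) 1, expX p Rx Ry γ) (⨅ γ ∈ Set.Icc (0 : ℝ) 1, expY p Rx Ry γ)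

end Exponents

/-! ### Randomized sequential codes -/

/-- The number of bits that a rate-`R` encoder emits at time `i + 1`, so that `⌊n R⌋` bits have
been emitted by time `n`. If `R` is a natural number this is `R` at all times. -/
def bitsAt (R : ℝ) (i : ℕ) : ℕ := ⌊((i : ℝ) + 1) * R⌋₊ - ⌊(i : ℝ) * R⌋₊

/-- The bits emitted by a rate-`R` encoder at the times `1, …, n`. -/
abbrev BitStream (R : ℝ) (n : ℕ) : Type := (i : Fin n) → Fin (bitsAt R i) → Bool

/-- A randomized sequential encoder-decoder triplet of rate `(Rx, Ry)`. The common randomness,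
shared by the encoders and the decoder, is a point `ω` of a probability space. At time `i + 1`
each encoder maps the `i + 1` source symbols it has seen so far to `bitsAt R i` bits; at time `n`
the decoder maps the two streams received so far to estimates of all `n` pairs of symbols. -/
structure SequentialCode (X : Type u) (Y : Type v) (Rx Ry : ℝ) where
  Ω : Type (max u v)
  [mΩ : MeasurableSpace Ω]
  μ : Measure Ω
  [isProb : IsProbabilityMeasure μ]
  encX : Ω → (i : ℕ) → (Fin (i + 1) → X) → Fin (bitsAt Rx i) → Bool
  encY : Ω → (i : ℕ) → (Fin (i + 1) → Y) → Fin (bitsAt Ry i) → Bool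
  dec : Ω → (n : ℕ) → BitStream Rx n → BitStream Ry n → (Fin n → X) × (Fin n → Y)
  measurable_encX : ∀ i x t, Measurable fun ω => encX ω i x t
  measurable_encY : ∀ i y t, Measurable fun ω => encY ω i y t
  measurableSet_dec : ∀ n a b z, MeasurableSet {ω | dec ω n a b = z}

attribute [instance] SequentialCode.mΩ SequentialCode.isProb

/-- The first `i + 1` symbols of a sequence of length `n > i`. -/
def initial {A : Type*} {n : ℕ} (s : Fin n → A) (i : Fin n) : Fin ((i : ℕ) + 1) → A :=
  fun t => s (Fin.castLE i.isLt t)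

namespace SequentialCode

variable {X : Type u} {Y : Type v} {Rx Ry : ℝ} (C : SequentialCode X Y Rx Ry)

/-- The bit stream that the `x`-encoder has emitted by time `n`. -/
def streamX (ω : C.Ω) {n : ℕ} (x : Fin n → X) : BitStream Rx n :=
  fun i => C.encX ω i (initial x i)

/-- The bit stream that the `y`-encoder has emitted by time `n`. -/
def streamY (ω : C.Ω) {n : ℕ} (y : Fin n → Y) : BitStream Ry n :=
  fun i => C.encY ω i (initial y i)

/-- The estimates at time `n` when the sources have emitted `x` and `y`. -/
def estimate (ω : C.Ω) {n : ℕ} (x : Fin n → X) (y : Fin n → Y) : (Fin n → X) × (Fin n → Y) :=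
  C.dec ω n (C.streamX ω x) (C.streamY ω y)

/-! The pairs `(x i, y i)` are i.i.d. with law `p` and independent of the common randomness. The
probability of an event is the sum, over all source realizations, of the probability of the
realization times the probability of the event over the common randomness. The symbols among the
first `n - Δ` are those at the (zero-based) positions `i` with `i + Δ < n`. -/

section ErrorProbabilities

variable [Fintype X] [Fintype Y]

/-- The probability that the estimate at time `n` of the first `n - Δ` symbols of `x` is wrong. -/
def errX (p : X × Y → ℝ) (n Δ : ℕ) : ℝ :=
  ∑ x : Fin n → X, ∑ y : Fin n → Y, (∏ i, p (x i, y i)) *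
    C.μ.real {ω | ∃ i : Fin n, (i : ℕ) + Δ < n ∧ (C.estimate ω x y).1 i ≠ x i}

/-- The probability that the estimate at time `n` of the first `n - Δ` symbols of `y` is wrong. -/
def errY (p : X × Y → ℝ) (n Δ : ℕ) : ℝ :=
  ∑ x : Fin n → X, ∑ y : Fin n → Y, (∏ i, p (x i, y i)) *
    C.μ.real {ω | ∃ i : Fin n, (i : ℕ) + Δ < n ∧ (C.estimate ω x y).2 i ≠ y i}

/-- The probability that the estimate at time `n` of the first `n - Δ` symbol pairs is wrong. -/
def errXY (p : X × Y → ℝ) (n Δ : ℕ) : ℝ :=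
  ∑ x : Fin n → X, ∑ y : Fin n → Y, (∏ i, p (x i, y i)) *
    C.μ.real {ω | ∃ i : Fin n, (i : ℕ) + Δ < n ∧
      ((C.estimate ω x y).1 i, (C.estimate ω x y).2 i) ≠ (x i, y i)}

end ErrorProbabilities

/-- Causal random binning: the bits assigned by the two encoders to the different prefixes, at all
times, are i.i.d. Bernoulli(1/2). -/
def IsRandomBinning : Prop :=
  iIndepFun
      (Sum.elim
        (fun (a : Σ i : ℕ, (Fin (i + 1) → X) × Fin (bitsAt Rx i)) ω =>
          C.encX ω a.1 a.2.1 a.2.2)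
        (fun (b : Σ i : ℕ, (Fin (i + 1) → Y) × Fin (bitsAt Ry i)) ω =>
          C.encY ω b.1 b.2.1 b.2.2)) C.μ
    ∧ (∀ i x t, C.μ {ω | C.encX ω i x t = true} = 1 / 2)
    ∧ (∀ i y t, C.μ {ω | C.encY ω i y t = true} = 1 / 2)

end SequentialCode

/-! ### Weighted suffix entropy decoding

Positions are zero-based: the divergence times `l, k` run over `0, …, n`, and `n` stands for
"no divergence". -/

open Classical in
/-- The type (empirical distribution) of the segment of `s` at the positions `a, …, b - 1`. -/
def segType {A : Type*} {n : ℕ} (s : Fin n → A) (a b : ℕ) : A → ℝ :=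
  fun c => (Finset.univ.filter fun i : Fin n => a ≤ (i : ℕ) ∧ (i : ℕ) < b ∧ s i = c).card
    / ((b : ℝ) - a)

/-- The type of a segment of a pair of sequences. -/
def jointType {A B : Type*} {n : ℕ} (x : Fin n → A) (y : Fin n → B) (a b : ℕ) : A × B → ℝ :=
  segType (fun i => (x i, y i)) a b

/-- The weighted suffix entropy of a pair of sequences with respect to the positions `l, k`. -/
def weightedSuffixEntropy {X Y : Type*} [Fintype X] [Fintype Y] {n : ℕ}
    (x : Fin n → X) (y : Fin n → Y) (l k : ℕ) : ℝ :=
  if l ≤ k then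
    ((k : ℝ) - l) / ((n : ℝ) - l) * condEntropy (jointType x y l k)
      + ((n : ℝ) - k) / ((n : ℝ) - l) * entropy (jointType x y k n)
  else
    ((l : ℝ) - k) / ((n : ℝ) - k) * condEntropy (jointType y x k l)
      + ((n : ℝ) - l) / ((n : ℝ) - k) * entropy (jointType x y l n)

/-- `s` and `s'` agree before position `l` and differ at position `l`
(they are equal if `l = n`). -/
def DivergeAt {A : Type*} {n : ℕ} (s s' : Fin n → A) (l : ℕ) : Prop :=
  (∀ i : Fin n, (i : ℕ) < l → s' i = s i) ∧ ∀ i : Fin n, (i : ℕ) = l → s' i ≠ s i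

section Decoder

variable {X : Type u} {Y : Type v} [Fintype X] [Fintype Y] {n : ℕ}

/-- Among the candidates in `Bx × By`, the pair `(x, y)` has strictly smaller weighted suffix
entropy than each pair that diverges from it at `(l, k)`. -/
def Beats (Bx : Set (Fin n → X)) (By : Set (Fin n → Y)) (x : Fin n → X) (y : Fin n → Y)
    (l k : ℕ) : Prop :=
  ∀ x' ∈ Bx, ∀ y' ∈ By, DivergeAt x x' l → DivergeAt y y' k →
    weightedSuffixEntropy x y l k < weightedSuffixEntropy x' y' l k

open Classical in
/-- The `x`-score of `(x, y)`: the largest `i ≤ n` such that `(x, y)` wins at all `(l, k)` with `l`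
among the first `i` positions. -/
def scoreX (Bx : Set (Fin n → X)) (By : Set (Fin n → Y)) (x : Fin n → X) (y : Fin n → Y) : ℕ :=
  Nat.findGreatest (fun i => ∀ l < i, ∀ k ≤ n, Beats Bx By x y l k) n

open Classical in
/-- The `y`-score of `(x, y)`: the largest `i ≤ n` such that `(x, y)` wins at all `(l, k)` with `k`
among the first `i` positions. -/
def scoreY (Bx : Set (Fin n → X)) (By : Set (Fin n → Y)) (x : Fin n → X) (y : Fin n → Y) : ℕ :=
  Nat.findGreatest (fun i => ∀ k < i, ∀ l ≤ n, Beats Bx By x y l k) n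

/-- The candidates for `x` that occur in a candidate pair with the largest `x`-score. -/
def winnersX (Bx : Set (Fin n → X)) (By : Set (Fin n → Y)) : Set (Fin n → X) :=
  {x | x ∈ Bx ∧ ∃ y ∈ By, ∀ x' ∈ Bx, ∀ y' ∈ By, scoreX Bx By x' y' ≤ scoreX Bx By x y}

/-- The candidates for `y` that occur in a candidate pair with the largest `y`-score. -/
def winnersY (Bx : Set (Fin n → X)) (By : Set (Fin n → Y)) : Set (Fin n → Y) :=
  {y | y ∈ By ∧ ∃ x ∈ Bx, ∀ x' ∈ Bx, ∀ y' ∈ By, scoreY Bx By x' y' ≤ scoreY Bx By x y}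

/-- The decoder applies the weighted suffix entropy rule: whatever streams `a, b` it receives (from
some source sequences), its estimates are winners among the sequences that are encoded as `a` and
as `b`. -/
def SequentialCode.IsWeightedSuffixEntropyDecoding {Rx Ry : ℝ} (C : SequentialCode X Y Rx Ry) :
    Prop :=
  ∀ (ω : C.Ω) (n : ℕ) (a : BitStream Rx n) (b : BitStream Ry n),
    {x | C.streamX ω x = a}.Nonempty → {y | C.streamY ω y = b}.Nonempty →
      (C.dec ω n a b).1 ∈ winnersX {x | C.streamX ω x = a} {y | C.streamY ω y = b} ∧
      (C.dec ω n a b).2 ∈ winnersY {x | C.streamX ω x = a} {y | C.streamY ω y = b}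

end Decoder

end StreamingSW

end

/-! Idea of the proof. Call the source pair confusable at `(l, k)` if some pair in the same bins
diverges from it at `(l, k)` and has no larger weighted suffix entropy. An error in `x` before `n -
Δ` forces confusability at some `l < n - Δ` and some `k ≤ n`. Otherwise the source pair scores at
least `n - Δ`, hence so does any winner; if the two disagreed before `n - Δ`, each would strictly
beat the other (`eq_of_mem_winnersX`).

Fix `l ≤ k`. A pair diverging at `(l, k)` is binned by fresh bits from these times on, so it
collides with the source with probability at most `4 * 2 ^ (-B)`, where `B = (n - l) Rx + (n - k)
Ry` (`measure_collision_le`). With `S` the weighted suffix entropy, `2 ^ (-(n - l) S)` is the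
probability that a suffix receives from its own empirical laws. As there are polynomially many
types, these numbers have polynomial sum over the diverging pairs (`sum_diverging_le`). The union
bound, cut off at `1`, is thus a polynomial times `2 ^ (-|B - (n - l) S|⁺)`. A source segment has
probability `2 ^ (-length * (D + H))`; the divergences `D` and the positive part make up `n - l`
times the objective of `expX` at `γ = (k - l) / (n - l)`, and the entropies `H` leave another sum of
universal probabilities, again polynomial (`sum_source_mul_le`).

For `k < l` the sources exchange roles, and the exponent is `n - k` times `expY` at `γ = (l - k) /
(n - k)`. Since `n - l = (1 - γ) (n - k)`, measuring it in units of `n - l` produces the factor `1 /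
(1 - γ)`.

It remains to sum over `(l, k)`. The bound in `n - l` does not control the sum over `k`. Compactness
and the rate conditions give a second bound, with some positive rate in `n - min l k`; interpolating
with a small weight on it makes the sum converge at an arbitrarily small loss of exponent
(`exists_sum_le`). -/

namespace StreamingSW

/-! ### Types of segments -/

section Types

variable {A : Type*} {n : ℕ}

/-- The positions `a, …, b - 1` of a sequence of length `n`. -/
def segment (n a b : ℕ) : Finset (Fin n) :=
  Finset.univ.filter fun i => a ≤ (i : ℕ) ∧ (i : ℕ) < b

theorem mem_segment {a b : ℕ} {i : Fin n} : i ∈ segment n a b ↔ a ≤ (i : ℕ) ∧ (i : ℕ) < b := by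
  simp [segment]

theorem card_segment {a b : ℕ} (hb : b ≤ n) : (segment n a b).card = b - a := by
  rw [← Nat.card_Ico]
  refine Finset.card_bij (fun i _ => (i : ℕ)) ?_ ?_ ?_
  · intro i hi
    simpa using mem_segment.1 hi
  · intro i _ j _ h
    exact Fin.ext h
  · intro j hj
    have hj' := Finset.mem_Ico.1 hj
    exact ⟨⟨j, by omega⟩, mem_segment.2 hj', rfl⟩

open Classical in
-- Clearing the denominator makes the identity hold for empty segments too, where the type is zero.
theorem mul_segType (z : Fin n → A) {a b : ℕ} (hb : b ≤ n) (c : A) :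
    ((b : ℝ) - a) * segType z a b c = ((segment n a b).filter fun i => z i = c).card := by
  have hfil : (Finset.univ.filter fun i : Fin n => a ≤ (i : ℕ) ∧ (i : ℕ) < b ∧ z i = c)
      = (segment n a b).filter fun i => z i = c := by
    ext i; simp [segment, and_assoc]
  rw [segType, hfil]
  rcases eq_or_ne ((b : ℝ) - a) 0 with h | h
  · have : (segment n a b).card = 0 := by
      rw [card_segment hb]
      have : (b : ℝ) = a := by linarith
      have : b = a := by exact_mod_cast this
      omega
    have h' : ((segment n a b).filter fun i => z i = c).card = 0 :=
      Nat.le_zero.1 (this ▸ Finset.card_filter_le _ _)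
    simp [h, h']
  · field_simp

theorem segType_nonneg (z : Fin n → A) {a b : ℕ} (hab : a ≤ b) (c : A) : 0 ≤ segType z a b c := by
  have : (a : ℝ) ≤ b := by exact_mod_cast hab
  exact div_nonneg (Nat.cast_nonneg _) (by linarith)

theorem segType_pos (z : Fin n → A) {a b : ℕ} {i : Fin n} (hi : i ∈ segment n a b) :
    0 < segType z a b (z i) := by
  classical
  have h := mem_segment.1 hi
  have : (a : ℝ) < b := by exact_mod_cast (h.1.trans_lt h.2)
  refine div_pos (Nat.cast_pos.2 (Finset.card_pos.2 ⟨i, ?_⟩)) (by linarith)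
  simp [h.1, h.2]

theorem exists_of_segType_ne_zero (z : Fin n → A) {a b : ℕ} {c : A} (hc : segType z a b c ≠ 0) :
    ∃ i ∈ segment n a b, z i = c := by
  classical
  by_contra h
  push Not at h
  apply hc
  rw [segType, Finset.card_eq_zero.2, Nat.cast_zero, zero_div]
  refine Finset.filter_eq_empty_iff.2 fun i _ hi => h i (mem_segment.2 ⟨hi.1, hi.2.1⟩) hi.2.2

theorem segType_self (z : Fin n → A) (a : ℕ) : segType z a a = 0 := by
  funext c; simp [segType]

variable [Fintype A]

theorem sum_segment (z : Fin n → A) {a b : ℕ} (hb : b ≤ n) (f : A → ℝ) :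
    ∑ i ∈ segment n a b, f (z i) = ((b : ℝ) - a) * ∑ c, segType z a b c * f c := by
  classical
  rw [Finset.mul_sum, ← Finset.sum_fiberwise_of_maps_to (t := Finset.univ) (g := z)
    (fun i _ => Finset.mem_univ _)]
  refine Finset.sum_congr rfl fun c _ => ?_
  rw [← mul_assoc, mul_segType z hb, ← nsmul_eq_mul]
  refine Finset.sum_eq_card_nsmul fun i hi => ?_
  rw [(Finset.mem_filter.1 hi).2]

theorem segType_mem_stdSimplex (z : Fin n → A) {a b : ℕ} (hab : a < b) (hb : b ≤ n) :
    segType z a b ∈ stdSimplex ℝ A := by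
  refine ⟨segType_nonneg z hab.le, ?_⟩
  have h := sum_segment z (a := a) hb (fun _ => (1 : ℝ))
  have hab' : (a : ℝ) < b := by exact_mod_cast hab
  simp only [Finset.sum_const, nsmul_eq_mul, mul_one, card_segment hb,
    Nat.cast_sub hab.le] at h
  have h0 : (b : ℝ) - a ≠ 0 := by linarith
  exact mul_left_cancel₀ h0 (by rw [mul_one]; exact h.symm)

theorem sum_segType_le_one (z : Fin n → A) {a b : ℕ} (hab : a ≤ b) (hb : b ≤ n) :
    ∑ c, segType z a b c ≤ 1 := by
  rcases hab.eq_or_lt with rfl | h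
  · simp [segType_self]
  · exact (segType_mem_stdSimplex z h hb).2.le

theorem prod_segment_eq_rpow (z : Fin n → A) {a b : ℕ} (hb : b ≤ n) (f : A → ℝ)
    (hf : ∀ i ∈ segment n a b, 0 < f (z i)) :
    ∏ i ∈ segment n a b, f (z i)
      = (2 : ℝ) ^ (((b : ℝ) - a) * ∑ c, segType z a b c * Real.logb 2 (f c)) := by
  rw [← sum_segment z hb, Real.rpow_sum_of_pos two_pos]
  exact Finset.prod_congr rfl fun i hi =>
    (Real.rpow_logb two_pos (by norm_num) (hf i hi)).symm

/-- An empirical law gives its own segment probability 2 to the minus length times entropy; this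
turns entropies into probabilities that can be summed. -/
theorem prod_segType (z : Fin n → A) {a b : ℕ} (hb : b ≤ n) :
    ∏ i ∈ segment n a b, segType z a b (z i)
      = (2 : ℝ) ^ (-(((b : ℝ) - a) * entropy (segType z a b))) := by
  rw [prod_segment_eq_rpow z hb _ fun i hi => segType_pos z hi, entropy]
  congr 1; ring

/-- The set of types of the segments `a, …, b - 1`. -/
noncomputable def types (A : Type*) [Fintype A] (n a b : ℕ) : Finset (A → ℝ) := by
  classical exact Finset.univ.image fun z : Fin n → A => segType z a b

theorem segType_mem_types (z : Fin n → A) (a b : ℕ) : segType z a b ∈ types A n a b := by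
  classical exact Finset.mem_image_of_mem _ (Finset.mem_univ z)

theorem exists_of_mem_types {q : A → ℝ} {a b : ℕ} (hq : q ∈ types A n a b) :
    ∃ z : Fin n → A, segType z a b = q := by
  classical
  obtain ⟨z, -, hz⟩ := Finset.mem_image.1 hq
  exact ⟨z, hz⟩

/-- A type is determined by its counts, each between `0` and the length. A free bound `m` on the
length lets both segments of a suffix use the same polynomial. -/
theorem card_types_le {a b m : ℕ} (hb : b ≤ n) (hm : b - a ≤ m) :
    (types A n a b).card ≤ (m + 1) ^ Fintype.card A := by
  classical
  have hsub : types A n a b ⊆ (Finset.univ : Finset (A → Fin (m + 1))).image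
      fun N c => ((N c : ℕ) : ℝ) / ((b : ℝ) - a) := by
    intro q hq
    obtain ⟨z, rfl⟩ := exists_of_mem_types hq
    refine Finset.mem_image.2 ⟨fun c => ⟨(Finset.univ.filter fun i : Fin n =>
      a ≤ (i : ℕ) ∧ (i : ℕ) < b ∧ z i = c).card, ?_⟩, Finset.mem_univ _, ?_⟩
    · refine Nat.lt_succ_of_le (le_trans ?_ hm)
      rw [← card_segment hb]
      exact Finset.card_le_card fun i hi => mem_segment.2
        ⟨(Finset.mem_filter.1 hi).2.1, (Finset.mem_filter.1 hi).2.2.1⟩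
    · funext c
      simp only [segType]
  calc (types A n a b).card ≤ _ := Finset.card_le_card hsub
    _ ≤ _ := Finset.card_image_le
    _ = _ := by simp [Finset.card_univ]

end Types

/-! ### Conditional types. -/

section Conditional

variable {X Y : Type*} [Fintype X] {n : ℕ}

/-- The conditional distribution of the first component given the second one. -/
noncomputable def channel (q : X × Y → ℝ) (c : X × Y) : ℝ := q c / ∑ x, q (x, c.2)

theorem channel_nonneg {q : X × Y → ℝ} (hq : ∀ c, 0 ≤ q c) (c : X × Y) : 0 ≤ channel q c :=
  div_nonneg (hq c) (Finset.sum_nonneg fun _ _ => hq _)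

/-- Only an inequality: where the marginal of `y` vanishes, division by zero makes the sum `0`. -/
theorem sum_channel_le_one (q : X × Y → ℝ) (y : Y) : ∑ x, channel q (x, y) ≤ 1 := by
  simp only [channel, ← Finset.sum_div]
  exact div_self_le_one _

variable [Fintype Y]

theorem condEntropy_eq (q : X × Y → ℝ) :
    condEntropy q = -∑ c, q c * Real.logb 2 (channel q c) := by
  rw [condEntropy, Fintype.sum_prod_type]; rfl

theorem prod_channel (x : Fin n → X) (y : Fin n → Y) {a b : ℕ} (hb : b ≤ n) :
    ∏ i ∈ segment n a b, channel (jointType x y a b) (x i, y i)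
      = (2 : ℝ) ^ (-(((b : ℝ) - a) * condEntropy (jointType x y a b))) := by
  have hpos : ∀ i ∈ segment n a b, 0 < channel (jointType x y a b) (x i, y i) := fun i hi => by
    have h := mem_segment.1 hi
    have h0 : 0 < jointType x y a b (x i, y i) := segType_pos (fun i => (x i, y i)) hi
    refine div_pos h0 (h0.trans_le ?_)
    exact Finset.single_le_sum (f := fun x' => jointType x y a b (x', y i))
      (fun _ _ => segType_nonneg _ (h.1.trans h.2.le) _) (Finset.mem_univ (x i))
  have h := prod_segment_eq_rpow (fun i => (x i, y i)) hb (channel (jointType x y a b)) hpos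
  rw [h, condEntropy_eq, jointType]
  congr 1; ring

end Conditional

/-! ### Sums of universal probabilities -/

theorem sum_pairs {ι X Y : Type*} [Fintype ι] [DecidableEq ι] [Fintype X] [Fintype Y]
    (f : (ι → X × Y) → ℝ) : ∑ z, f z = ∑ x : ι → X, ∑ y : ι → Y, f fun i => (x i, y i) := by
  rw [← (Equiv.arrowProdEquivProdArrow ι (fun _ => X) (fun _ => Y)).symm.sum_comp,
    Fintype.sum_prod_type]
  rfl

theorem sum_prod_le_one {ι A : Type*} [Fintype ι] [DecidableEq ι] [Fintype A] (g : ι → A → ℝ)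
    (h0 : ∀ i c, 0 ≤ g i c) (h1 : ∀ i, ∑ c, g i c ≤ 1) : ∑ z : ι → A, ∏ i, g i (z i) ≤ 1 := by
  classical
  have h := Finset.prod_univ_sum (fun _ : ι => (Finset.univ : Finset A)) g
  rw [Fintype.piFinset_univ] at h
  rw [← h]
  exact Finset.prod_le_one (fun i _ => Finset.sum_nonneg fun c _ => h0 i c) fun i _ => h1 i

/-- Merging the three segments into one product over positions lets a sum over sequences factorize.
-/
theorem prod_segments {M : Type*} [CommMonoid M] {n l k : ℕ} (hlk : l ≤ k) (f g h : Fin n → M) :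
    (∏ i ∈ segment n 0 l, f i) * (∏ i ∈ segment n l k, g i) * ∏ i ∈ segment n k n, h i
      = ∏ i : Fin n, if (i : ℕ) < l then f i else if (i : ℕ) < k then g i else h i := by
  simp only [segment, Finset.prod_filter, ← Finset.prod_mul_distrib]
  refine Finset.prod_congr rfl fun i _ => ?_
  have := i.isLt
  by_cases h1 : (i : ℕ) < l
  · simp [h1, show ¬ l ≤ (i : ℕ) by omega, show ¬ k ≤ (i : ℕ) by omega]
  · by_cases h2 : (i : ℕ) < k
    · simp [h1, h2, show l ≤ (i : ℕ) by omega, show ¬ k ≤ (i : ℕ) by omega]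
    · simp [h1, h2, show k ≤ (i : ℕ) by omega]

/-- For fixed types the summand is a product of subprobabilities and has sum at most one. Letting
the types depend on `z` costs at most a factor equal to the number of pairs of types. -/
theorem sum_universal_le {A : Type*} [Fintype A] {n l k : ℕ} (hlk : l ≤ k) (hkn : k ≤ n)
    (u : Fin n → A → ℝ) (w : (A → ℝ) → Fin n → A → ℝ)
    (hu0 : ∀ i c, 0 ≤ u i c) (hu1 : ∀ i, ∑ c, u i c ≤ 1)
    (hw0 : ∀ q ∈ types A n l k, ∀ i c, 0 ≤ w q i c)
    (hw1 : ∀ q ∈ types A n l k, ∀ i, ∑ c, w q i c ≤ 1) :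
    ∑ z : Fin n → A, (∏ i ∈ segment n 0 l, u i (z i))
        * (∏ i ∈ segment n l k, w (segType z l k) i (z i))
        * ∏ i ∈ segment n k n, segType z k n (z i)
      ≤ ((n - l : ℕ) + 1 : ℝ) ^ (2 * Fintype.card A) := by
  have hr0 : ∀ r ∈ types A n k n, ∀ c, 0 ≤ r c := fun r hr c => by
    obtain ⟨z, rfl⟩ := exists_of_mem_types hr
    exact segType_nonneg z hkn c
  have hr1 : ∀ r ∈ types A n k n, ∑ c, r c ≤ 1 := fun r hr => by
    obtain ⟨z, rfl⟩ := exists_of_mem_types hr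
    exact sum_segType_le_one z hkn le_rfl
  let F : (A → ℝ) → (A → ℝ) → (Fin n → A) → ℝ := fun q r z =>
    (∏ i ∈ segment n 0 l, u i (z i)) * (∏ i ∈ segment n l k, w q i (z i))
      * ∏ i ∈ segment n k n, r (z i)
  have hF0 : ∀ q ∈ types A n l k, ∀ r ∈ types A n k n, ∀ z, 0 ≤ F q r z := fun q hq r hr z =>
    mul_nonneg (mul_nonneg (Finset.prod_nonneg fun i _ => hu0 _ _)
      (Finset.prod_nonneg fun i _ => hw0 q hq _ _)) (Finset.prod_nonneg fun i _ => hr0 r hr _)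
  have hF1 : ∀ q ∈ types A n l k, ∀ r ∈ types A n k n, ∑ z, F q r z ≤ 1 := fun q hq r hr => by
    simp only [F, prod_segments hlk]
    refine sum_prod_le_one (fun (i : Fin n) c => if (i : ℕ) < l then u i c else if (i : ℕ) < k then w q i c
      else r c) (fun i c => ?_) (fun i => ?_)
    · split_ifs
      exacts [hu0 _ _, hw0 q hq _ _, hr0 r hr _]
    · split_ifs
      exacts [hu1 _, hw1 q hq _, hr1 r hr]
  calc _ = ∑ z : Fin n → A, F (segType z l k) (segType z k n) z := rfl
    _ ≤ ∑ z : Fin n → A, ∑ q ∈ types A n l k, ∑ r ∈ types A n k n, F q r z := by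
        -- The term with the actual types of `z` is one of the nonnegative terms of the double sum.
        refine Finset.sum_le_sum fun z _ => ?_
        refine le_trans ?_ (Finset.single_le_sum (f := fun q => ∑ r ∈ types A n k n, F q r z)
          (fun q hq => Finset.sum_nonneg fun r hr => hF0 q hq r hr z) (segType_mem_types z l k))
        exact Finset.single_le_sum (f := fun r => F (segType z l k) r z)
          (fun r hr => hF0 _ (segType_mem_types z l k) r hr z) (segType_mem_types z k n)
    _ = ∑ q ∈ types A n l k, ∑ r ∈ types A n k n, ∑ z : Fin n → A, F q r z := by
        rw [Finset.sum_comm]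
        exact Finset.sum_congr rfl fun q _ => Finset.sum_comm
    _ ≤ ∑ q ∈ types A n l k, ∑ r ∈ types A n k n, (1 : ℝ) :=
        Finset.sum_le_sum fun q hq => Finset.sum_le_sum fun r hr => hF1 q hq r hr
    _ = ((types A n l k).card : ℝ) * (types A n k n).card := by simp
    _ ≤ ((n - l : ℕ) + 1 : ℝ) ^ Fintype.card A * ((n - l : ℕ) + 1 : ℝ) ^ Fintype.card A := by
        refine mul_le_mul ?_ ?_ (Nat.cast_nonneg _) (by positivity)
        · exact_mod_cast card_types_le (A := A) (m := n - l) hkn (by omega)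
        · exact_mod_cast card_types_le (A := A) (m := n - l) le_rfl (by omega)
    _ = _ := by rw [two_mul, pow_add]

section Pairs

variable {X Y : Type*} [Fintype X] [Fintype Y] {n l k : ℕ}

theorem mul_weightedSuffixEntropy (x : Fin n → X) (y : Fin n → Y) (hlk : l ≤ k) (hl : l < n) :
    ((n : ℝ) - l) * weightedSuffixEntropy x y l k
      = ((k : ℝ) - l) * condEntropy (jointType x y l k)
        + ((n : ℝ) - k) * entropy (jointType x y k n) := by
  have : (l : ℝ) < n := by exact_mod_cast hl
  have h0 : (n : ℝ) - l ≠ 0 := by linarith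
  rw [weightedSuffixEntropy, if_pos hlk]
  field_simp

open Classical in
/-- The pairs of sequences that diverge from `(x, y)` at `(l, k)` have few small weighted suffix
entropies. -/
theorem sum_diverging_le (x : Fin n → X) (y : Fin n → Y) (hlk : l ≤ k) (hkn : k ≤ n)
    (hl : l < n) :
    ∑ x' : Fin n → X, ∑ y' : Fin n → Y,
        (if DivergeAt x x' l ∧ DivergeAt y y' k then
          (2 : ℝ) ^ (-(((n : ℝ) - l) * weightedSuffixEntropy x' y' l k)) else 0)
      ≤ ((n - l : ℕ) + 1 : ℝ) ^ (2 * Fintype.card (X × Y)) := by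
  have hq0 : ∀ q ∈ types (X × Y) n l k, ∀ c, 0 ≤ q c := fun q hq c => by
    obtain ⟨z, rfl⟩ := exists_of_mem_types hq
    exact segType_nonneg z hlk c
  refine le_trans ?_ (sum_universal_le (A := X × Y) hlk hkn
    -- Point masses express agreement with both sequences before `l`; between `l` and `k` only `y`
    -- is prescribed, so the channel weighs the symbol of `x'`.
    (fun i c => if c = (x i, y i) then 1 else 0)
    (fun q i c => if c.2 = y i then channel q c else 0) ?_ ?_ ?_ ?_)
  · rw [sum_pairs]
    refine Finset.sum_le_sum fun x' _ => Finset.sum_le_sum fun y' _ => ?_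
    split_ifs with hF
    · obtain ⟨⟨hx, -⟩, hy, -⟩ := hF
      rw [mul_weightedSuffixEntropy x' y' hlk hl, neg_add, Real.rpow_add two_pos,
        ← prod_channel x' y' hkn, jointType, jointType, ← prod_segType _ le_rfl]
      refine le_of_eq ?_
      congr 1
      rw [Finset.prod_eq_one (s := segment n 0 l), one_mul]
      · refine Finset.prod_congr rfl fun i hi => ?_
        rw [if_pos (hy i (mem_segment.1 hi).2)]
      · intro i hi
        have hi' := (mem_segment.1 hi).2
        exact if_pos (Prod.ext (hx i hi') (hy i (hi'.trans_le hlk)))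
    · refine mul_nonneg (mul_nonneg (Finset.prod_nonneg fun i _ => ?_)
        (Finset.prod_nonneg fun i _ => ?_)) (Finset.prod_nonneg fun i _ => ?_)
      · split_ifs <;> norm_num
      · split_ifs
        exacts [channel_nonneg (hq0 _ (segType_mem_types _ l k)) _, le_rfl]
      · exact segType_nonneg _ hkn _
  · intro i c
    split_ifs <;> norm_num
  · intro i
    simp
  · intro q hq i c
    split_ifs
    exacts [channel_nonneg (hq0 q hq) c, le_rfl]
  · intro q hq i
    rw [Fintype.sum_prod_type]
    refine le_trans (le_of_eq ?_) (sum_channel_le_one q (y i))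
    refine Finset.sum_congr rfl fun x' _ => ?_
    rw [Finset.sum_ite_eq' Finset.univ (y i) (fun y' => channel q (x', y'))]
    simp

end Pairs

/-- The averaging counterpart of `sum_diverging_le`: the source law stays on the prefix, and the
suffix segments carry their own types. -/
theorem sum_source_le {A : Type*} [Fintype A] {n l k : ℕ} (hlk : l ≤ k) (hkn : k ≤ n)
    {p : A → ℝ} (hp : p ∈ stdSimplex ℝ A) :
    ∑ z : Fin n → A, (∏ i ∈ segment n 0 l, p (z i))
        * (2 : ℝ) ^ (-(((k : ℝ) - l) * entropy (segType z l k)))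
        * (2 : ℝ) ^ (-(((n : ℝ) - k) * entropy (segType z k n)))
      ≤ ((n - l : ℕ) + 1 : ℝ) ^ (2 * Fintype.card A) := by
  refine le_trans (le_of_eq ?_) (sum_universal_le (A := A) hlk hkn
    (fun _ => p) (fun q _ => q) (fun _ => hp.1) (fun _ => hp.2.le) ?_ ?_)
  · refine Finset.sum_congr rfl fun z _ => ?_
    rw [← prod_segType z hkn, ← prod_segType z le_rfl]
  · intro q hq _ c
    obtain ⟨z, rfl⟩ := exists_of_mem_types hq
    exact segType_nonneg z hlk c
  · intro q hq _
    obtain ⟨z, rfl⟩ := exists_of_mem_types hq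
    exact sum_segType_le_one z hlk hkn

/-! ### Divergence -/

section Divergence

variable {A : Type*} [Fintype A]

/-- The Kullback-Leibler divergence, in bits, as a real number, for `q ≪ p`. -/
noncomputable def realKL (q p : A → ℝ) : ℝ := ∑ a, q a * Real.logb 2 (q a / p a)

theorem kl_of_absCont {q p : A → ℝ} (h : ∀ a, p a = 0 → q a = 0) :
    kl q p = ENNReal.ofReal (realKL q p) := if_pos h

theorem sum_mul_logb_eq {q p : A → ℝ} (h : ∀ a, p a = 0 → q a = 0) :
    ∑ a, q a * Real.logb 2 (p a) = -(realKL q p + entropy q) := by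
  rw [realKL, entropy, ← sub_eq_add_neg, ← Finset.sum_sub_distrib, ← Finset.sum_neg_distrib]
  refine Finset.sum_congr rfl fun a _ => ?_
  by_cases hq : q a = 0
  · simp [hq]
  · rw [Real.logb_div hq fun hp => hq (h a hp)]
    ring

/-- The divergence is at least the squared Hellinger distance. -/
theorem hellinger_le_realKL {q p : A → ℝ} (hq : q ∈ stdSimplex ℝ A) (hp : p ∈ stdSimplex ℝ A)
    (h : ∀ a, p a = 0 → q a = 0) : ∑ a, (√(q a) - √(p a)) ^ 2 ≤ realKL q p := by
  have hterm : ∀ a, 2 * q a - 2 * (√(q a) * √(p a)) ≤ q a * Real.log (q a / p a) := fun a => by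
    rcases (hq.1 a).eq_or_lt with h0 | h0
    · simp [← h0]
    have hp0 : 0 < p a := lt_of_le_of_ne (hp.1 a) fun h' => h0.ne' (h a h'.symm)
    have hs : 0 < √(q a) := Real.sqrt_pos.2 h0
    have ht : 0 < √(p a) := Real.sqrt_pos.2 hp0
    -- `log t ≤ t - 1` is applied at `t = √(p a / q a)`.
    have h1 := Real.log_le_sub_one_of_pos (div_pos ht hs)
    have h2 : Real.log (q a / p a) = -(2 * Real.log (√(p a) / √(q a))) := by
      rw [Real.log_div h0.ne' hp0.ne', Real.log_div ht.ne' hs.ne', Real.log_sqrt h0.le,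
        Real.log_sqrt hp0.le]
      ring
    have h3 : q a * (√(p a) / √(q a)) = √(q a) * √(p a) := by
      rw [← mul_div_assoc, div_eq_iff hs.ne']
      nth_rw 1 [← Real.mul_self_sqrt h0.le]
      ring
    rw [h2]
    nlinarith [mul_le_mul_of_nonneg_left h1 h0.le]
  have hsum : ∑ a, (√(q a) - √(p a)) ^ 2 ≤ ∑ a, q a * Real.log (q a / p a) := by
    refine le_trans (le_of_eq ?_) (Finset.sum_le_sum fun a _ => hterm a)
    have h1 : ∀ a, (√(q a) - √(p a)) ^ 2 = q a + p a - 2 * (√(q a) * √(p a)) := fun a => by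
      rw [sub_sq, Real.sq_sqrt (hq.1 a), Real.sq_sqrt (hp.1 a)]; ring
    simp only [h1, Finset.sum_sub_distrib, Finset.sum_add_distrib, ← Finset.mul_sum, hq.2, hp.2]
    norm_num
  have hnn : 0 ≤ ∑ a, (√(q a) - √(p a)) ^ 2 := Finset.sum_nonneg fun a _ => sq_nonneg _
  have heq : realKL q p = (∑ a, q a * Real.log (q a / p a)) / Real.log 2 := by
    simp only [realKL, Real.logb, Finset.sum_div, mul_div_assoc]
  rw [heq]
  -- Passing to base 2 only increases the divergence, because `log 2 ≤ 1`.
  refine hsum.trans (le_div_self (hnn.trans hsum) (Real.log_pos one_lt_two) ?_)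
  linarith [Real.log_two_lt_d9]

theorem realKL_nonneg {q p : A → ℝ} (hq : q ∈ stdSimplex ℝ A) (hp : p ∈ stdSimplex ℝ A)
    (h : ∀ a, p a = 0 → q a = 0) : 0 ≤ realKL q p :=
  (Finset.sum_nonneg fun _ _ => sq_nonneg _).trans (hellinger_le_realKL hq hp h)

end Divergence

/-! ### Change of measure and the averaged union bound at fixed divergence times. -/

section Exponent

variable {X Y : Type*} [Fintype X] [Fintype Y] {n l k : ℕ} {p : X × Y → ℝ} {Rx Ry e : ℝ}

theorem le_of_le_expX {γ : ℝ} (h0 : 0 ≤ γ) (h1 : γ ≤ 1) (hp : p ∈ stdSimplex ℝ (X × Y))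
    (he : ENNReal.ofReal e ≤ expX p Rx Ry γ) {q r : X × Y → ℝ}
    (hq : q ∈ stdSimplex ℝ (X × Y)) (hr : r ∈ stdSimplex ℝ (X × Y))
    (hqp : ∀ a, p a = 0 → q a = 0) (hrp : ∀ a, p a = 0 → r a = 0) :
    e ≤ γ * realKL q p + (1 - γ) * realKL r p
      + max 0 (γ * (Rx - condEntropy q) + (1 - γ) * (Rx + Ry - entropy r)) := by
  have hK := realKL_nonneg hq hp hqp
  have hK' := realKL_nonneg hr hp hrp
  have h1' : 0 ≤ 1 - γ := by linarith
  have hz : ∀ z : ℝ, ENNReal.ofReal z = ENNReal.ofReal (max 0 z) := fun z => by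
    simp [ENNReal.ofReal_max]
  have h := he.trans ((iInf₂_le q hq).trans (iInf₂_le r hr))
  have hnn : 0 ≤ γ * realKL q p + (1 - γ) * realKL r p :=
    add_nonneg (mul_nonneg h0 hK) (mul_nonneg h1' hK')
  rwa [kl_of_absCont hqp, kl_of_absCont hrp, ← ENNReal.ofReal_mul h0, ← ENNReal.ofReal_mul h1',
    ← ENNReal.ofReal_add (mul_nonneg h0 hK) (mul_nonneg h1' hK'),
    hz (γ * (Rx - condEntropy q) + _), ← ENNReal.ofReal_add hnn (le_max_left _ _),
    ENNReal.ofReal_le_ofReal_iff (add_nonneg hnn (le_max_left _ _))] at h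

theorem mul_le_of_le_expX (hp : p ∈ stdSimplex ℝ (X × Y)) (hlk : l ≤ k) (hkn : k ≤ n)
    (hl : l < n) (he : ENNReal.ofReal e ≤ expX p Rx Ry (((k : ℝ) - l) / ((n : ℝ) - l)))
    (x : Fin n → X) (y : Fin n → Y) (hxy : ∀ i, p (x i, y i) ≠ 0) :
    ((n : ℝ) - l) * e ≤ ((k : ℝ) - l) * realKL (jointType x y l k) p
      + ((n : ℝ) - k) * realKL (jointType x y k n) p
      + max 0 (((n : ℝ) - l) * Rx + ((n : ℝ) - k) * Ry
        - ((n : ℝ) - l) * weightedSuffixEntropy x y l k) := by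
  have hm : (0 : ℝ) < (n : ℝ) - l := by
    have : (l : ℝ) < n := by exact_mod_cast hl
    linarith
  have ha : (0 : ℝ) ≤ (k : ℝ) - l := by
    have : (l : ℝ) ≤ k := by exact_mod_cast hlk
    linarith
  have hb : (0 : ℝ) ≤ (n : ℝ) - k := by
    have : (k : ℝ) ≤ n := by exact_mod_cast hkn
    linarith
  have hac : ∀ a b c, p c = 0 → jointType x y a b c = 0 := fun a b c hc => by
    by_contra hne
    obtain ⟨i, -, hi⟩ := exists_of_segType_ne_zero _ hne
    exact hxy i (hi ▸ hc)
  -- The type of an empty segment is zero, hence not a distribution; its weight vanishes, so `p` can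
  -- replace it in the infimum.
  have key : ∀ a b : ℕ, a ≤ b → b ≤ n → ∃ q ∈ stdSimplex ℝ (X × Y), (∀ c, p c = 0 → q c = 0) ∧
      ∀ f : (X × Y → ℝ) → ℝ, ((b : ℝ) - a) * f q = ((b : ℝ) - a) * f (jointType x y a b) := by
    intro a b hab hbn
    rcases hab.eq_or_lt with rfl | hab'
    · exact ⟨p, hp, fun _ h => h, fun f => by simp⟩
    · exact ⟨_, segType_mem_stdSimplex _ hab' hbn, hac a b, fun f => rfl⟩
  obtain ⟨q, hq, hqp, hqf⟩ := key l k hlk hkn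
  obtain ⟨r, hr, hrp, hrf⟩ := key k n hkn le_rfl
  have h := le_of_le_expX (div_nonneg ha hm.le) (div_le_one_of_le₀ (by linarith) hm.le) hp he
    hq hr hqp hrp
  have h1 : 1 - ((k : ℝ) - l) / ((n : ℝ) - l) = ((n : ℝ) - k) / ((n : ℝ) - l) := by
    field_simp; ring
  rw [h1] at h
  have h2 := mul_le_mul_of_nonneg_left h hm.le
  rw [mul_add, mul_add, mul_max_of_nonneg _ _ hm.le, mul_zero, mul_add] at h2
  simp only [← mul_assoc, mul_div_cancel₀ _ hm.ne'] at h2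
  rw [hqf (fun q => realKL q p), hrf (fun r => realKL r p), hqf (fun q => Rx - condEntropy q),
    hrf (fun r => Rx + Ry - entropy r)] at h2
  refine h2.trans (le_of_eq ?_)
  rw [mul_weightedSuffixEntropy x y hlk hl]
  congr 2
  ring

/-- Change of measure: on a segment the source probability is 2 to the minus length times `D + H`.
The divergences and the positive part yield `e`, while the entropies are kept as universal
probabilities. If a symbol has probability zero, the left side vanishes. -/
theorem prod_source_mul_le (hp : p ∈ stdSimplex ℝ (X × Y)) (hlk : l ≤ k) (hkn : k ≤ n)
    (hl : l < n) (he : ENNReal.ofReal e ≤ expX p Rx Ry (((k : ℝ) - l) / ((n : ℝ) - l)))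
    (x : Fin n → X) (y : Fin n → Y) :
    (∏ i, p (x i, y i)) * (2 : ℝ) ^ (-max 0 (((n : ℝ) - l) * Rx + ((n : ℝ) - k) * Ry
        - ((n : ℝ) - l) * weightedSuffixEntropy x y l k))
      ≤ (∏ i ∈ segment n 0 l, p (x i, y i))
        * (2 : ℝ) ^ (-(((k : ℝ) - l) * entropy (jointType x y l k)))
        * (2 : ℝ) ^ (-(((n : ℝ) - k) * entropy (jointType x y k n)))
        * (2 : ℝ) ^ (-(((n : ℝ) - l) * e)) := by
  by_cases hxy : ∀ i, p (x i, y i) ≠ 0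
  · have hpos : ∀ i, 0 < p (x i, y i) := fun i => lt_of_le_of_ne (hp.1 _) (hxy i).symm
    have hac : ∀ a b c, p c = 0 → jointType x y a b c = 0 := fun a b c hc => by
      by_contra hne
      obtain ⟨i, -, hi⟩ := exists_of_segType_ne_zero _ hne
      exact hxy i (hi ▸ hc)
    have hsplit : (∏ i, p (x i, y i)) = (∏ i ∈ segment n 0 l, p (x i, y i))
        * (∏ i ∈ segment n l k, p (x i, y i)) * ∏ i ∈ segment n k n, p (x i, y i) := by
      rw [prod_segments hlk]; simp
    have h1 := prod_segment_eq_rpow (a := l) (fun i => (x i, y i)) hkn p fun i _ => hpos i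
    have h2 := prod_segment_eq_rpow (a := k) (fun i => (x i, y i)) le_rfl p fun i _ => hpos i
    rw [← jointType, sum_mul_logb_eq (hac _ _)] at h1 h2
    rw [hsplit, h1, h2, mul_assoc, mul_assoc, mul_assoc, mul_assoc]
    refine mul_le_mul_of_nonneg_left ?_ (Finset.prod_nonneg fun i _ => hp.1 _)
    simp only [← Real.rpow_add two_pos]
    refine Real.rpow_le_rpow_of_exponent_le one_le_two ?_
    have h := mul_le_of_le_expX hp hlk hkn hl he x y hxy
    simp only [jointType] at h ⊢
    linarith
  · push Not at hxy
    obtain ⟨i, hi⟩ := hxy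
    rw [Finset.prod_eq_zero (Finset.mem_univ i) hi, zero_mul]
    have := Finset.prod_nonneg fun (i : Fin n) (_ : i ∈ segment n 0 l) => hp.1 (x i, y i)
    positivity

open Classical in
/-- The union bound over the pairs that diverge from the source sequences at `(l, k)`. -/
theorem sum_source_mul_le (hp : p ∈ stdSimplex ℝ (X × Y)) (hlk : l ≤ k) (hkn : k ≤ n)
    (hl : l < n) (he : ENNReal.ofReal e ≤ expX p Rx Ry (((k : ℝ) - l) / ((n : ℝ) - l)))
    (G : (Fin n → X) → (Fin n → Y) → ℝ) (hG1 : ∀ x y, G x y ≤ 1)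
    (hG : ∀ x y, G x y ≤ ∑ x' : Fin n → X, ∑ y' : Fin n → Y,
      if (DivergeAt x x' l ∧ DivergeAt y y' k) ∧
        weightedSuffixEntropy x' y' l k ≤ weightedSuffixEntropy x y l k then
        4 * (2 : ℝ) ^ (-(((n : ℝ) - l) * Rx + ((n : ℝ) - k) * Ry)) else 0) :
    ∑ x, ∑ y, (∏ i, p (x i, y i)) * G x y
      ≤ 4 * ((n - l : ℕ) + 1 : ℝ) ^ (4 * Fintype.card (X × Y))
        * (2 : ℝ) ^ (-(((n : ℝ) - l) * e)) := by
  have hm : (0 : ℝ) < (n : ℝ) - l := by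
    have : (l : ℝ) < n := by exact_mod_cast hl
    linarith
  set N : ℝ := ((n - l : ℕ) + 1 : ℝ) ^ (2 * Fintype.card (X × Y)) with hN
  have hN1 : 1 ≤ N := one_le_pow₀ (by linarith [Nat.cast_nonneg (α := ℝ) (n - l)])
  have hG2 : ∀ x y, G x y ≤ 4 * N * (2 : ℝ) ^ (-max 0 (((n : ℝ) - l) * Rx + ((n : ℝ) - k) * Ry
        - ((n : ℝ) - l) * weightedSuffixEntropy x y l k)) := fun x y => by
    -- If the rate does not exceed the entropy, the union bound is useless and `G ≤ 1` is used.
    rcases le_total (((n : ℝ) - l) * Rx + ((n : ℝ) - k) * Ry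
        - ((n : ℝ) - l) * weightedSuffixEntropy x y l k) 0 with h | h
    · rw [max_eq_left h, neg_zero, Real.rpow_zero]
      linarith [hG1 x y]
    rw [max_eq_right h]
    set B := ((n : ℝ) - l) * Rx + ((n : ℝ) - k) * Ry
    set S := ((n : ℝ) - l) * weightedSuffixEntropy x y l k with hS
    have hsum : G x y ≤ ∑ x' : Fin n → X, ∑ y' : Fin n → Y, 4 * (2 : ℝ) ^ (-(B - S)) *
        (if DivergeAt x x' l ∧ DivergeAt y y' k then
          (2 : ℝ) ^ (-(((n : ℝ) - l) * weightedSuffixEntropy x' y' l k)) else 0) := by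
      refine (hG x y).trans (Finset.sum_le_sum fun x' _ => Finset.sum_le_sum fun y' _ => ?_)
      by_cases hF : DivergeAt x x' l ∧ DivergeAt y y' k
      · rw [if_pos hF]
        split_ifs with h'
        -- A competitor has suffix entropy `S' ≤ S` (scaled by `n - l`), so `2 ^ (-B) ≤ 2 ^ (-(B -
        -- S)) * 2 ^ (-S')`.
        · rw [mul_assoc, ← Real.rpow_add two_pos]
          refine mul_le_mul_of_nonneg_left
            (Real.rpow_le_rpow_of_exponent_le one_le_two ?_) (by norm_num)
          have := mul_le_mul_of_nonneg_left h'.2 hm.le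
          linarith
        · positivity
      · rw [if_neg hF, if_neg (fun h' => hF h'.1), mul_zero]
    simp only [← Finset.mul_sum] at hsum
    refine hsum.trans ?_
    rw [mul_right_comm 4 N]
    exact mul_le_mul_of_nonneg_left (sum_diverging_le x y hlk hkn hl) (by positivity)
  calc ∑ x, ∑ y, (∏ i, p (x i, y i)) * G x y
      ≤ ∑ x : Fin n → X, ∑ y : Fin n → Y, 4 * N * (2 : ℝ) ^ (-(((n : ℝ) - l) * e)) *
        ((∏ i ∈ segment n 0 l, p (x i, y i))
        * (2 : ℝ) ^ (-(((k : ℝ) - l) * entropy (jointType x y l k)))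
        * (2 : ℝ) ^ (-(((n : ℝ) - k) * entropy (jointType x y k n)))) := by
        refine Finset.sum_le_sum fun x _ => Finset.sum_le_sum fun y _ => ?_
        have h1 := mul_le_mul_of_nonneg_left (hG2 x y)
          (Finset.prod_nonneg fun i (_ : i ∈ Finset.univ) => hp.1 (x i, y i))
        have h2 := mul_le_mul_of_nonneg_left (prod_source_mul_le hp hlk hkn hl he x y)
          (show 0 ≤ 4 * N by positivity)
        refine h1.trans (le_trans (le_of_eq ?_) (h2.trans (le_of_eq ?_))) <;> ring
    _ ≤ 4 * N * (2 : ℝ) ^ (-(((n : ℝ) - l) * e)) * N := by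
        simp only [← Finset.mul_sum]
        refine mul_le_mul_of_nonneg_left ?_ (by positivity)
        have := sum_source_le (n := n) hlk hkn hp
        rwa [sum_pairs] at this
    _ = _ := by
        rw [hN]; ring

end Exponent

/-! ### Collision probabilities of random binning -/

/-- The probability that disjoint families of independent fair bits agree. -/
theorem measure_bits_agree_le {Ω ι J : Type*} [MeasurableSpace Ω] {μ : Measure Ω}
    [IsProbabilityMeasure μ] {B : ι → Ω → Bool} (hB : iIndepFun B μ)
    (hm : ∀ a, Measurable (B a)) (hfair : ∀ a, μ {ω | B a ω = true} = 1 / 2) [Fintype J]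
    {u v : J → ι} (huv : Function.Injective (Sum.elim u v)) :
    μ.real {ω | ∀ j, B (u j) ω = B (v j) ω} ≤ (2 : ℝ) ^ (-(Fintype.card J : ℝ)) := by
  classical
  have hhalf : ∀ a (c : Bool), μ (B a ⁻¹' {c}) = 1 / 2 := fun a c => by
    have htrue : μ (B a ⁻¹' {true}) = 1 / 2 := hfair a
    cases c with
    | true => exact htrue
    | false =>
      have hc : B a ⁻¹' {false} = (B a ⁻¹' {true})ᶜ := by ext ω; simp
      rw [hc, prob_compl_eq_one_sub (hm a (measurableSet_singleton _)), htrue]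
      simp
  have hpre := hB.precomp huv
  -- Split by the common pattern `c`: there are `2 ^ |J|` patterns, and each prescribes `2 |J|`
  -- distinct independent bits.
  have hsub : {ω | ∀ j, B (u j) ω = B (v j) ω} ⊆ ⋃ c : J → Bool,
      ⋂ j ∈ (Finset.univ : Finset (J ⊕ J)), B (Sum.elim u v j) ⁻¹' {Sum.elim c c j} := by
    intro ω hω
    refine Set.mem_iUnion.2 ⟨fun j => B (u j) ω, Set.mem_iInter₂.2 fun j _ => ?_⟩
    cases j with
    | inl j => rfl
    | inr j => exact (hω j).symm
  have hle : μ {ω | ∀ j, B (u j) ω = B (v j) ω} ≤ (1 / 2) ^ Fintype.card J := by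
    refine (measure_mono hsub).trans ((measure_iUnion_fintype_le _ _).trans (le_of_eq ?_))
    have hc : ∀ c : J → Bool, μ (⋂ j ∈ (Finset.univ : Finset (J ⊕ J)),
        B (Sum.elim u v j) ⁻¹' {Sum.elim c c j})
          = (1 / 2) ^ Fintype.card J * (1 / 2) ^ Fintype.card J := fun c => by
      rw [hpre.measure_inter_preimage_eq_mul Finset.univ
        (sets := fun j => {Sum.elim c c j}) (fun j _ => measurableSet_singleton _)]
      simp only [hhalf, Finset.prod_const, Finset.card_univ, Fintype.card_sum, pow_add]
    simp only [hc, Finset.sum_const, Finset.card_univ, Fintype.card_fun, Fintype.card_bool,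
      nsmul_eq_mul]
    rw [← mul_assoc, Nat.cast_pow, ← mul_pow, Nat.cast_ofNat, one_div,
      ENNReal.mul_inv_cancel two_ne_zero ENNReal.ofNat_ne_top, one_pow, one_mul]
  refine (ENNReal.toReal_mono (by simp) hle).trans (le_of_eq ?_)
  rw [Real.rpow_neg zero_le_two, Real.rpow_natCast]
  simp

/-- The floors telescope, so at most one bit is lost; at a negative rate the left side is negative.
-/
theorem le_sum_bitsAt (R : ℝ) {l n : ℕ} (hl : l ≤ n) :
    ((n : ℝ) - l) * R - 1 ≤ ∑ i ∈ Finset.Ico l n, (bitsAt R i : ℝ) := by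
  have hln : (l : ℝ) ≤ n := by exact_mod_cast hl
  rcases lt_or_ge R 0 with hR | hR
  · have h0 : (0 : ℝ) ≤ ∑ i ∈ Finset.Ico l n, (bitsAt R i : ℝ) :=
      Finset.sum_nonneg fun i _ => Nat.cast_nonneg _
    nlinarith
  have htel : ∀ m, l ≤ m →
      (⌊(m : ℝ) * R⌋₊ : ℝ) - ⌊(l : ℝ) * R⌋₊ ≤ ∑ i ∈ Finset.Ico l m, (bitsAt R i : ℝ) := by
    intro m hm
    induction m, hm using Nat.le_induction with
    | base => simp
    | succ m hm ih =>
      rw [Finset.sum_Ico_succ_top hm]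
      have h : ⌊((m + 1 : ℕ) : ℝ) * R⌋₊ ≤ bitsAt R m + ⌊(m : ℝ) * R⌋₊ := by
        rw [bitsAt, Nat.cast_succ]; omega
      have h' : (⌊((m + 1 : ℕ) : ℝ) * R⌋₊ : ℝ) ≤ bitsAt R m + ⌊(m : ℝ) * R⌋₊ := by
        exact_mod_cast h
      linarith
  have h1 := htel n hl
  have h2 := Nat.lt_floor_add_one ((n : ℝ) * R)
  have h3 := Nat.floor_le (mul_nonneg (Nat.cast_nonneg (α := ℝ) l) hR)
  linarith

theorem initial_ne {A : Type*} {n l : ℕ} {s s' : Fin n → A} (h : DivergeAt s s' l) {i : Fin n}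
    (hi : l ≤ (i : ℕ)) : initial s' i ≠ initial s i := fun h' =>
  h.2 ⟨l, hi.trans_lt i.isLt⟩ rfl (congrFun h' ⟨l, Nat.lt_succ_of_le hi⟩)

section Collision

/-- The bits which a rate-`R` encoder assigns to the prefixes longer than `l` of a sequence. -/
def bitIndex {A : Type*} {n : ℕ} (R : ℝ) (l : ℕ) (s : Fin n → A)
    (j : Σ i : Finset.Ico l n, Fin (bitsAt R i)) :
    Σ i : ℕ, (Fin (i + 1) → A) × Fin (bitsAt R i) :=
  ⟨j.1, initial s ⟨j.1, (Finset.mem_Ico.1 j.1.2).2⟩, j.2⟩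

theorem bitIndex_injective {A : Type*} {n : ℕ} (R : ℝ) (l : ℕ) (s : Fin n → A) :
    Function.Injective (bitIndex R l s) := by
  rintro ⟨⟨i, hi⟩, t⟩ ⟨⟨i', hi'⟩, t'⟩ h
  obtain rfl : i = i' := congrArg Sigma.fst h
  simp only [bitIndex, Sigma.mk.injEq, heq_eq_eq, Prod.mk.injEq, true_and] at h
  rw [h]

theorem bitIndex_ne {A : Type*} {n : ℕ} (R : ℝ) {l : ℕ} {s s' : Fin n → A}
    (h : DivergeAt s s' l) (j j' : Σ i : Finset.Ico l n, Fin (bitsAt R i)) :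
    bitIndex R l s' j ≠ bitIndex R l s j' := by
  obtain ⟨⟨i, hi⟩, t⟩ := j
  obtain ⟨⟨i', hi'⟩, t'⟩ := j'
  intro h'
  obtain rfl : i = i' := congrArg Sigma.fst h'
  simp only [bitIndex, Sigma.mk.injEq, heq_eq_eq, Prod.mk.injEq, true_and] at h'
  exact initial_ne h (i := ⟨i, (Finset.mem_Ico.1 hi).2⟩) (Finset.mem_Ico.1 hi).1 h'.1

variable {X : Type*} {Y : Type*} {Rx Ry : ℝ} {C : SequentialCode X Y Rx Ry} {n l k : ℕ}

/-- Prefixes longer than the divergence time differ, so their bits are distinct members of the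
independent family, in both streams at once. -/
theorem SequentialCode.IsRandomBinning.measure_collision_le (hC : C.IsRandomBinning)
    {x x' : Fin n → X} {y y' : Fin n → Y} (hl : l ≤ n) (hk : k ≤ n) (hx : DivergeAt x x' l)
    (hy : DivergeAt y y' k) :
    C.μ.real {ω | C.streamX ω x' = C.streamX ω x ∧ C.streamY ω y' = C.streamY ω y}
      ≤ 4 * (2 : ℝ) ^ (-(((n : ℝ) - l) * Rx + ((n : ℝ) - k) * Ry)) := by
  obtain ⟨hind, hfx, hfy⟩ := hC
  have hinj : Function.Injective (Sum.elim
      (Sum.map (bitIndex Rx l x') (bitIndex Ry k y'))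
      (Sum.map (bitIndex Rx l x) (bitIndex Ry k y))) := by
    refine Function.Injective.sumElim
      (Function.Injective.sumMap (bitIndex_injective _ _ _) (bitIndex_injective _ _ _))
      (Function.Injective.sumMap (bitIndex_injective _ _ _) (bitIndex_injective _ _ _)) ?_
    rintro (j | j) (j' | j') h
    · exact bitIndex_ne Rx hx j j' (Sum.inl_injective h)
    · cases h
    · cases h
    · exact bitIndex_ne Ry hy j j' (Sum.inr_injective h)
  have h := measure_bits_agree_le hind
    (by rintro (a | a); exacts [C.measurable_encX _ _ _, C.measurable_encY _ _ _])
    (by rintro (a | a); exacts [hfx _ _ _, hfy _ _ _]) hinj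
  refine le_trans (measureReal_mono ?_) (h.trans ?_)
  · rintro ω ⟨h1, h2⟩ (⟨i, t⟩ | ⟨i, t⟩)
    · exact congrFun (congrFun h1 ⟨i, (Finset.mem_Ico.1 i.2).2⟩) t
    · exact congrFun (congrFun h2 ⟨i, (Finset.mem_Ico.1 i.2).2⟩) t
  · have hX := le_sum_bitsAt Rx hl
    have hY := le_sum_bitsAt Ry hk
    rw [← Finset.sum_coe_sort] at hX hY
    -- The factor `4` pays for one bit lost to rounding in each stream.
    rw [show (4 : ℝ) = 2 ^ (2 : ℝ) by norm_num, ← Real.rpow_add two_pos]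
    refine Real.rpow_le_rpow_of_exponent_le one_le_two ?_
    simp only [Fintype.card_sum, Fintype.card_sigma, Fintype.card_fin, Nat.cast_add,
      Nat.cast_sum]
    linarith

end Collision

/-! ### Symmetry between the two sources -/

section Symmetry

variable {X Y : Type*} {n : ℕ}

theorem jointType_swap (x : Fin n → X) (y : Fin n → Y) (a b : ℕ) :
    jointType y x a b = swapped (jointType x y a b) := by
  funext c
  have h : ∀ i, (y i, x i) = c ↔ (x i, y i) = (c.2, c.1) := fun i => by
    simp [Prod.ext_iff, and_comm]
  refine congrArg (fun N : ℕ => (N : ℝ) / ((b : ℝ) - a)) (congrArg Finset.card ?_)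
  ext i
  simp only [Finset.mem_filter, h]

variable [Fintype X] [Fintype Y]

theorem entropy_swapped (q : X × Y → ℝ) : entropy (swapped q) = entropy q := by
  rw [entropy, entropy, ← (Equiv.prodComm X Y).sum_comp]
  rfl

theorem kl_swapped (q p : X × Y → ℝ) : kl (swapped q) (swapped p) = kl q p := by
  have h : (∀ a, swapped p a = 0 → swapped q a = 0) ↔ ∀ a, p a = 0 → q a = 0 :=
    (Equiv.prodComm Y X).forall_congr fun _ => Iff.rfl
  rw [kl, kl, if_congr h rfl rfl, ← (Equiv.prodComm X Y).sum_comp]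
  rfl

theorem swapped_mem_stdSimplex {q : X × Y → ℝ} (hq : q ∈ stdSimplex ℝ (X × Y)) :
    swapped q ∈ stdSimplex ℝ (Y × X) :=
  ⟨fun _ => hq.1 _, by rw [← hq.2, ← (Equiv.prodComm Y X).sum_comp]; rfl⟩

/-- With this symmetry the averaged union bound and the positivity argument are needed for `expX`
only. -/
theorem expY_eq_expX_swapped (p : X × Y → ℝ) (Rx Ry γ : ℝ) :
    expY p Rx Ry γ = expX (swapped p) Ry Rx γ := by
  refine le_antisymm ?_ ?_
  · refine le_iInf₂ fun q hq => le_iInf₂ fun r hr => ?_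
    refine (iInf₂_le (swapped q) (swapped_mem_stdSimplex hq)).trans
      ((iInf₂_le (swapped r) (swapped_mem_stdSimplex hr)).trans (le_of_eq ?_))
    rw [← kl_swapped, ← kl_swapped (swapped r), entropy_swapped, add_comm Rx Ry]
    rfl
  · refine le_iInf₂ fun q hq => le_iInf₂ fun r hr => ?_
    refine (iInf₂_le (swapped q) (swapped_mem_stdSimplex hq)).trans
      ((iInf₂_le (swapped r) (swapped_mem_stdSimplex hr)).trans (le_of_eq ?_))
    rw [kl_swapped, kl_swapped, entropy_swapped, add_comm Rx Ry]

/-- The two cases of the definition are exchanged; at `l = k` both reduce to the joint entropy of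
the common suffix. -/
theorem weightedSuffixEntropy_swap (x : Fin n → X) (y : Fin n → Y) (l k : ℕ) :
    weightedSuffixEntropy y x k l = weightedSuffixEntropy x y l k := by
  have he : ∀ a b, entropy (jointType y x a b) = entropy (jointType x y a b) := fun a b => by
    rw [jointType_swap, entropy_swapped]
  rcases lt_trichotomy l k with h | rfl | h
  · rw [weightedSuffixEntropy, weightedSuffixEntropy, if_neg (not_le.2 h), if_pos h.le, he]
  · rw [weightedSuffixEntropy, weightedSuffixEntropy, if_pos le_rfl, if_pos le_rfl, he]
    simp
  · rw [weightedSuffixEntropy, weightedSuffixEntropy, if_pos h.le, if_neg (not_le.2 h), he]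

theorem beats_swap {Bx : Set (Fin n → X)} {By : Set (Fin n → Y)} {x : Fin n → X} {y : Fin n → Y}
    {l k : ℕ} : Beats By Bx y x k l ↔ Beats Bx By x y l k := by
  have hs : ∀ (x : Fin n → X) (y : Fin n → Y), weightedSuffixEntropy y x k l
      = weightedSuffixEntropy x y l k := fun x y => weightedSuffixEntropy_swap x y l k
  rw [Beats, Beats, hs]
  exact ⟨fun h x' hx y' hy h1 h2 => hs x' y' ▸ h y' hy x' hx h2 h1,
    fun h y' hy x' hx h2 h1 => (hs x' y').symm ▸ h x' hx y' hy h1 h2⟩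

theorem scoreX_swap (Bx : Set (Fin n → X)) (By : Set (Fin n → Y)) (x : Fin n → X)
    (y : Fin n → Y) : scoreX By Bx y x = scoreY Bx By x y := by
  have h : ∀ l k, Beats By Bx y x k l ↔ Beats Bx By x y l k := fun _ _ => beats_swap
  rw [scoreX, scoreY]
  congr! 6
  exact h _ _

theorem winnersX_swap (Bx : Set (Fin n → X)) (By : Set (Fin n → Y)) :
    winnersX By Bx = winnersY Bx By := by
  ext y
  simp only [winnersX, winnersY, scoreX_swap, Set.mem_ofPred_eq]
  exact ⟨fun ⟨h, x, hx, h'⟩ => ⟨h, x, hx, fun x' hx' y' hy' => h' y' hy' x' hx'⟩,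
    fun ⟨h, x, hx, h'⟩ => ⟨h, x, hx, fun y' hy' x' hx' => h' x' hx' y' hy'⟩⟩

end Symmetry

/-! ### Decoding errors and confusable pairs -/

section Winners

theorem exists_divergeAt {A : Type*} {n : ℕ} (s s' : Fin n → A) : ∃ l ≤ n, DivergeAt s s' l := by
  classical
  by_cases h : ∃ l, ∃ i : Fin n, (i : ℕ) = l ∧ s' i ≠ s i
  · obtain ⟨i, hi, hne⟩ := Nat.find_spec h
    refine ⟨Nat.find h, hi ▸ i.isLt.le, fun j hj => ?_, fun j hj => ?_⟩
    · by_contra hne'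
      exact Nat.find_min h hj ⟨j, rfl, hne'⟩
    · rwa [Fin.ext (hj.trans hi.symm)]
  · push Not at h
    exact ⟨n, le_rfl, fun i _ => h i i rfl, fun i hi => absurd hi i.isLt.ne⟩

theorem DivergeAt.symm {A : Type*} {n l : ℕ} {s s' : Fin n → A} (h : DivergeAt s s' l) :
    DivergeAt s' s l :=
  ⟨fun i hi => (h.1 i hi).symm, fun i hi => (h.2 i hi).symm⟩

variable {X Y : Type*} [Fintype X] [Fintype Y] {n N : ℕ} {Bx : Set (Fin n → X)}
  {By : Set (Fin n → Y)}

/-- If the source pair beats all pairs that diverge before `N` in the first component, then all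
winners agree with it before `N`. -/
theorem eq_of_mem_winnersX {x z : Fin n → X} {y : Fin n → Y} (hz : z ∈ winnersX Bx By)
    (hx : x ∈ Bx) (hy : y ∈ By) (hN : N ≤ n)
    (h : ∀ l < N, ∀ k ≤ n, Beats Bx By x y l k) (i : Fin n) (hi : (i : ℕ) < N) : z i = x i := by
  classical
  obtain ⟨hzB, w, hw, hmax⟩ := hz
  have h1 : N ≤ scoreX Bx By x y := Nat.le_findGreatest hN h
  have h2 : ∀ l < scoreX Bx By z w, ∀ k ≤ n, Beats Bx By z w l k :=
    Nat.findGreatest_spec (P := fun i => ∀ l < i, ∀ k ≤ n, Beats Bx By z w l k)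
      (Nat.zero_le n) (fun l hl => absurd hl (Nat.not_lt_zero l))
  obtain ⟨l, -, hl⟩ := exists_divergeAt x z
  obtain ⟨k, hk, hk'⟩ := exists_divergeAt y w
  rcases lt_or_ge (i : ℕ) l with hil | hil
  · exact hl.1 i hil
  -- The winning pair and the source pair diverge at the same `(l, k)` and both win there, which is
  -- impossible.
  have h3 := h l (hil.trans_lt hi) k hk z hzB w hw hl hk'
  have h4 := h2 l ((hil.trans_lt hi).trans_le (h1.trans (hmax x hx y hy))) k hk x hx y hy
    hl.symm hk'.symm
  exact absurd h3 h4.not_gt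

theorem eq_of_mem_winnersY {x : Fin n → X} {y z : Fin n → Y} (hz : z ∈ winnersY Bx By)
    (hx : x ∈ Bx) (hy : y ∈ By) (hN : N ≤ n)
    (h : ∀ k < N, ∀ l ≤ n, Beats Bx By x y l k) (i : Fin n) (hi : (i : ℕ) < N) : z i = y i :=
  eq_of_mem_winnersX (winnersX_swap Bx By ▸ hz) hy hx hN
    (fun k hk l hl => beats_swap.2 (h k hk l hl)) i hi

end Winners

/-! ### Union bounds for decoding errors in terms of confusable pairs. -/

namespace SequentialCode

variable {X : Type*} {Y : Type*} [Fintype X] [Fintype Y] {Rx Ry : ℝ}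
  (C : SequentialCode X Y Rx Ry)

/-- Some pair with the same encoding as `(x, y)` diverges from it at `(l, k)` and has no larger
weighted suffix entropy. -/
def Confusable (ω : C.Ω) {n : ℕ} (x : Fin n → X) (y : Fin n → Y) (l k : ℕ) : Prop :=
  ∃ x' y', (C.streamX ω x' = C.streamX ω x ∧ C.streamY ω y' = C.streamY ω y) ∧
    (DivergeAt x x' l ∧ DivergeAt y y' k) ∧
    weightedSuffixEntropy x' y' l k ≤ weightedSuffixEntropy x y l k

/-- The probability that the source pair is confusable at `(l, k)` at time `n`. -/
noncomputable def confusionProb (p : X × Y → ℝ) (n l k : ℕ) : ℝ :=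
  ∑ x : Fin n → X, ∑ y : Fin n → Y, (∏ i, p (x i, y i)) * C.μ.real {ω | C.Confusable ω x y l k}

variable {C} {p : X × Y → ℝ}

theorem exists_confusable_of_estimateX (hC : C.IsWeightedSuffixEntropyDecoding) {ω : C.Ω}
    {n Δ : ℕ} {x : Fin n → X} {y : Fin n → Y} {i : Fin n} (hi : (i : ℕ) + Δ < n)
    (hne : (C.estimate ω x y).1 i ≠ x i) :
    ∃ l ∈ Finset.range (n - Δ), ∃ k ∈ Finset.range (n + 1), C.Confusable ω x y l k := by
  by_contra hcon
  refine hne (eq_of_mem_winnersX (N := n - Δ) (hC ω n _ _ ⟨x, rfl⟩ ⟨y, rfl⟩).1 rfl rfl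
    (Nat.sub_le _ _) (fun l hl k hk x' hx' y' hy' h1 h2 => ?_) i (by omega))
  by_contra hle
  exact hcon ⟨l, Finset.mem_range.2 hl, k, Finset.mem_range.2 (Nat.lt_succ_of_le hk), x', y',
    ⟨hx', hy'⟩, ⟨h1, h2⟩, not_lt.1 hle⟩

theorem exists_confusable_of_estimateY (hC : C.IsWeightedSuffixEntropyDecoding) {ω : C.Ω}
    {n Δ : ℕ} {x : Fin n → X} {y : Fin n → Y} {i : Fin n} (hi : (i : ℕ) + Δ < n)
    (hne : (C.estimate ω x y).2 i ≠ y i) :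
    ∃ k ∈ Finset.range (n - Δ), ∃ l ∈ Finset.range (n + 1), C.Confusable ω x y l k := by
  by_contra hcon
  refine hne (eq_of_mem_winnersY (N := n - Δ) (hC ω n _ _ ⟨x, rfl⟩ ⟨y, rfl⟩).2 rfl rfl
    (Nat.sub_le _ _) (fun k hk l hl x' hx' y' hy' h1 h2 => ?_) i (by omega))
  by_contra hle
  exact hcon ⟨k, Finset.mem_range.2 hk, l, Finset.mem_range.2 (Nat.lt_succ_of_le hl), x', y',
    ⟨hx', hy'⟩, ⟨h1, h2⟩, not_lt.1 hle⟩

theorem prod_source_nonneg (hp : p ∈ stdSimplex ℝ (X × Y)) {n : ℕ} (x : Fin n → X)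
    (y : Fin n → Y) : 0 ≤ ∏ i, p (x i, y i) :=
  Finset.prod_nonneg fun _ _ => hp.1 _

/-- A union bound, averaged over the source sequences. -/
theorem sum_source_union_le (hp : p ∈ stdSimplex ℝ (X × Y)) {n : ℕ} (S T : Finset ℕ)
    (A : (Fin n → X) → (Fin n → Y) → Set C.Ω)
    (B : ℕ → ℕ → (Fin n → X) → (Fin n → Y) → Set C.Ω)
    (h : ∀ x y, ∀ ω ∈ A x y, ∃ l ∈ S, ∃ k ∈ T, ω ∈ B l k x y) :
    ∑ x, ∑ y, (∏ i, p (x i, y i)) * C.μ.real (A x y)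
      ≤ ∑ l ∈ S, ∑ k ∈ T, ∑ x, ∑ y, (∏ i, p (x i, y i)) * C.μ.real (B l k x y) := by
  have hle : ∀ x y, C.μ.real (A x y) ≤ ∑ l ∈ S, ∑ k ∈ T, C.μ.real (B l k x y) := fun x y => by
    have hsub : A x y ⊆ ⋃ l ∈ S, ⋃ k ∈ T, B l k x y := fun ω hω => by
      obtain ⟨l, hl, k, hk, hB⟩ := h x y ω hω
      exact Set.mem_biUnion hl (Set.mem_biUnion hk hB)
    exact (measureReal_mono hsub (measure_ne_top _ _)).trans ((measureReal_biUnion_finset_le _ _).trans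
      (Finset.sum_le_sum fun l _ => measureReal_biUnion_finset_le _ _))
  calc _ ≤ ∑ x, ∑ y, (∏ i, p (x i, y i)) * ∑ l ∈ S, ∑ k ∈ T, C.μ.real (B l k x y) :=
        Finset.sum_le_sum fun x _ => Finset.sum_le_sum fun y _ =>
          mul_le_mul_of_nonneg_left (hle x y) (prod_source_nonneg hp x y)
    _ = ∑ z : (Fin n → X) × (Fin n → Y), ∑ w ∈ S ×ˢ T,
          (∏ i, p (z.1 i, z.2 i)) * C.μ.real (B w.1 w.2 z.1 z.2) := by
        simp only [Fintype.sum_prod_type, Finset.sum_product, Finset.mul_sum]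
    _ = _ := by
        rw [Finset.sum_comm]
        simp only [Fintype.sum_prod_type, Finset.sum_product]

theorem errX_le (hC : C.IsWeightedSuffixEntropyDecoding) (hp : p ∈ stdSimplex ℝ (X × Y))
    (n Δ : ℕ) : C.errX p n Δ
      ≤ ∑ l ∈ Finset.range (n - Δ), ∑ k ∈ Finset.range (n + 1), C.confusionProb p n l k :=
  sum_source_union_le hp _ _ _ (fun l k x y => {ω | C.Confusable ω x y l k})
    fun _ _ _ ⟨_, hi, hne⟩ => exists_confusable_of_estimateX hC hi hne

theorem errY_le (hC : C.IsWeightedSuffixEntropyDecoding) (hp : p ∈ stdSimplex ℝ (X × Y))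
    (n Δ : ℕ) : C.errY p n Δ
      ≤ ∑ k ∈ Finset.range (n - Δ), ∑ l ∈ Finset.range (n + 1), C.confusionProb p n l k :=
  sum_source_union_le hp _ _ _ (fun k l x y => {ω | C.Confusable ω x y l k})
    fun _ _ _ ⟨_, hi, hne⟩ => exists_confusable_of_estimateY hC hi hne

theorem errXY_le (hp : p ∈ stdSimplex ℝ (X × Y)) (n Δ : ℕ) :
    C.errXY p n Δ ≤ C.errX p n Δ + C.errY p n Δ := by
  simp only [errXY, errX, errY, ← Finset.sum_add_distrib, ← mul_add]
  refine Finset.sum_le_sum fun x _ => Finset.sum_le_sum fun y _ =>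
    mul_le_mul_of_nonneg_left ?_ (prod_source_nonneg hp x y)
  refine (measureReal_mono ?_).trans (measureReal_union_le _ _)
  rintro ω ⟨i, hi, hne⟩
  by_cases h : (C.estimate ω x y).1 i = x i
  · exact Or.inr ⟨i, hi, fun h' => hne (Prod.ext h h')⟩
  · exact Or.inl ⟨i, hi, h⟩

theorem sum_source_le_one (hp : p ∈ stdSimplex ℝ (X × Y)) {n : ℕ}
    (A : (Fin n → X) → (Fin n → Y) → Set C.Ω) :
    ∑ x, ∑ y, (∏ i, p (x i, y i)) * C.μ.real (A x y) ≤ 1 := by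
  have h := sum_prod_le_one (fun _ : Fin n => p) (fun _ => hp.1) (fun _ => hp.2.le)
  rw [sum_pairs] at h
  exact (Finset.sum_le_sum fun x _ => Finset.sum_le_sum fun y _ =>
    mul_le_of_le_one_right (prod_source_nonneg hp x y) measureReal_le_one).trans h

open Classical in
theorem measure_confusable_le (hC : C.IsRandomBinning) {n l k : ℕ} (hl : l ≤ n) (hk : k ≤ n)
    (x : Fin n → X) (y : Fin n → Y) :
    C.μ.real {ω | C.Confusable ω x y l k} ≤ ∑ x' : Fin n → X, ∑ y' : Fin n → Y,
      if (DivergeAt x x' l ∧ DivergeAt y y' k) ∧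
        weightedSuffixEntropy x' y' l k ≤ weightedSuffixEntropy x y l k then
        4 * (2 : ℝ) ^ (-(((n : ℝ) - l) * Rx + ((n : ℝ) - k) * Ry)) else 0 := by
  have hsub : {ω | C.Confusable ω x y l k} ⊆ ⋃ x' : Fin n → X, ⋃ y' : Fin n → Y,
      {ω | (C.streamX ω x' = C.streamX ω x ∧ C.streamY ω y' = C.streamY ω y) ∧
        (DivergeAt x x' l ∧ DivergeAt y y' k) ∧
        weightedSuffixEntropy x' y' l k ≤ weightedSuffixEntropy x y l k} :=
    fun ω ⟨x', y', h⟩ => Set.mem_iUnion.2 ⟨x', Set.mem_iUnion.2 ⟨y', h⟩⟩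
  refine (measureReal_mono hsub).trans ((measureReal_iUnion_fintype_le _).trans
    (Finset.sum_le_sum fun x' _ => (measureReal_iUnion_fintype_le _).trans
      (Finset.sum_le_sum fun y' _ => ?_)))
  split_ifs with h
  · exact (measureReal_mono fun ω hω => hω.1).trans (hC.measure_collision_le hl hk h.1.1 h.1.2)
  · refine le_of_eq ?_
    convert measureReal_empty
    exact Set.eq_empty_of_forall_notMem fun ω hω => h hω.2

theorem confusionProb_le_of_le (hC : C.IsRandomBinning) (hp : p ∈ stdSimplex ℝ (X × Y))
    {n l k : ℕ} (hlk : l ≤ k) (hkn : k ≤ n) (hl : l < n) {e : ℝ}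
    (he : ENNReal.ofReal e ≤ expX p Rx Ry (((k : ℝ) - l) / ((n : ℝ) - l))) :
    C.confusionProb p n l k ≤ 4 * ((n - l : ℕ) + 1 : ℝ) ^ (4 * Fintype.card (X × Y))
        * (2 : ℝ) ^ (-(((n : ℝ) - l) * e)) := by
  classical
  exact sum_source_mul_le hp hlk hkn hl he _ (fun _ _ => measureReal_le_one)
    fun x y => measure_confusable_le hC hl.le hkn x y

theorem confusionProb_le_of_ge (hC : C.IsRandomBinning) (hp : p ∈ stdSimplex ℝ (X × Y))
    {n l k : ℕ} (hkl : k ≤ l) (hln : l ≤ n) (hk : k < n) {e : ℝ}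
    (he : ENNReal.ofReal e ≤ expY p Rx Ry (((l : ℝ) - k) / ((n : ℝ) - k))) :
    C.confusionProb p n l k ≤ 4 * ((n - k : ℕ) + 1 : ℝ) ^ (4 * Fintype.card (X × Y))
        * (2 : ℝ) ^ (-(((n : ℝ) - k) * e)) := by
  classical
  rw [expY_eq_expX_swapped] at he
  have h := sum_source_mul_le (swapped_mem_stdSimplex hp) hkl hln hk he
    (fun y x => C.μ.real {ω | C.Confusable ω x y l k}) (fun _ _ => measureReal_le_one) ?_
  · rw [confusionProb, Finset.sum_comm, Fintype.card_prod, mul_comm (Fintype.card X),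
      ← Fintype.card_prod]
    exact h
  · intro y x
    refine (measure_confusable_le hC hln hk.le x y).trans (le_of_eq ?_)
    rw [Finset.sum_comm]
    refine Finset.sum_congr rfl fun y' _ => Finset.sum_congr rfl fun x' _ => ?_
    rw [weightedSuffixEntropy_swap x y l k, weightedSuffixEntropy_swap x' y' l k,
      add_comm (((n : ℝ) - k) * Ry)]
    simp only [and_comm (a := DivergeAt x x' l)]

end SequentialCode

/-! ### Positivity of the exponents -/

section Positivity

variable {A X Y : Type*} [Fintype A] [Fintype X] [Fintype Y]

/-- The Hellinger bound is finite and continuous even where the divergence is infinite, so it can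
replace the divergence in a compactness argument. -/
theorem ofReal_hellinger_le_kl {q p : A → ℝ} (hq : q ∈ stdSimplex ℝ A)
    (hp : p ∈ stdSimplex ℝ A) : ENNReal.ofReal (∑ a, (√(q a) - √(p a)) ^ 2) ≤ kl q p := by
  by_cases h : ∀ a, p a = 0 → q a = 0
  · rw [kl_of_absCont h]
    exact ENNReal.ofReal_le_ofReal (hellinger_le_realKL hq hp h)
  · rw [kl, if_neg h]
    exact le_top

theorem eq_of_hellinger_eq_zero {q p : A → ℝ} (hq : ∀ a, 0 ≤ q a) (hp : ∀ a, 0 ≤ p a)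
    (h : ∑ a, (√(q a) - √(p a)) ^ 2 = 0) : q = p := by
  funext a
  have h' := (Finset.sum_eq_zero_iff_of_nonneg fun a _ => sq_nonneg _).1 h a (Finset.mem_univ a)
  exact (Real.sqrt_inj (hq a) (hp a)).1 (sub_eq_zero.1 (pow_eq_zero_iff two_ne_zero |>.1 h'))

theorem continuous_entropy : Continuous (entropy : (A → ℝ) → ℝ) := by
  have h : (entropy : (A → ℝ) → ℝ) = fun q => ∑ a, Real.negMulLog (q a) / Real.log 2 := by
    funext q
    rw [entropy, ← Finset.sum_neg_distrib]
    refine Finset.sum_congr rfl fun a _ => ?_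
    rw [Real.negMulLog, Real.logb]; ring
  rw [h]
  exact continuous_finsetSum _ fun a _ =>
    (Real.continuous_negMulLog.comp (continuous_apply a)).div_const _

/-- The chain rule, which removes the quotient inside the logarithm and thereby gives continuity on
the simplex. -/
theorem condEntropy_eq_sub {q : X × Y → ℝ} (hq : ∀ c, 0 ≤ q c) :
    condEntropy q = entropy q - entropy fun y => ∑ x, q (x, y) := by
  have h : ∀ c, q c * Real.logb 2 (channel q c)
      = q c * Real.logb 2 (q c) - q c * Real.logb 2 (∑ x, q (x, c.2)) := fun c => by
    rcases (hq c).eq_or_lt with h0 | h0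
    · simp [← h0]
    · have h1 : 0 < ∑ x, q (x, c.2) := h0.trans_le
        (Finset.single_le_sum (f := fun x => q (x, c.2)) (fun _ _ => hq _) (Finset.mem_univ c.1))
      rw [channel, Real.logb_div h0.ne' h1.ne', mul_sub]
  rw [condEntropy_eq, entropy, entropy]
  simp only [h, Finset.sum_sub_distrib]
  have h2 : ∑ c, q c * Real.logb 2 (∑ x, q (x, c.2))
      = ∑ y, (∑ x, q (x, y)) * Real.logb 2 (∑ x, q (x, y)) := by
    rw [Fintype.sum_prod_type, Finset.sum_comm]
    simp only [Finset.sum_mul]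
  rw [h2]
  ring

theorem continuousOn_condEntropy :
    ContinuousOn (condEntropy : (X × Y → ℝ) → ℝ) (stdSimplex ℝ (X × Y)) := by
  refine ContinuousOn.congr (f := fun q => entropy q - entropy fun y => ∑ x, q (x, y)) ?_
    fun q hq => condEntropy_eq_sub hq.1
  refine (continuous_entropy.sub (continuous_entropy.comp ?_)).continuousOn
  fun_prop

/-- With divergences replaced by Hellinger distances, the objective is continuous on a compact set
and attains its minimum over `(γ, q, r)`. That minimum is positive and serves as `e`, uniformly in
`γ`. -/
theorem exists_pos_le_expX {p : X × Y → ℝ} (hp : p ∈ stdSimplex ℝ (X × Y)) {Rx Ry : ℝ}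
    (hx : condEntropy p < Rx) (hxy : entropy p < Rx + Ry) :
    ∃ e : ℝ, 0 < e ∧ ∀ γ ∈ Set.Icc (0 : ℝ) 1, ENNReal.ofReal e ≤ expX p Rx Ry γ := by
  let D : (X × Y → ℝ) → ℝ := fun q => ∑ a, (√(q a) - √(p a)) ^ 2
  have hD : ∀ q, 0 ≤ D q := fun q => Finset.sum_nonneg fun _ _ => sq_nonneg _
  have hDc : Continuous D := by
    dsimp only [D]
    fun_prop
  let F : ℝ × (X × Y → ℝ) × (X × Y → ℝ) → ℝ := fun t =>
    t.1 * D t.2.1 + (1 - t.1) * D t.2.2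
      + max 0 (t.1 * (Rx - condEntropy t.2.1) + (1 - t.1) * (Rx + Ry - entropy t.2.2))
  let S : Set (ℝ × (X × Y → ℝ) × (X × Y → ℝ)) :=
    Set.Icc (0 : ℝ) 1 ×ˢ stdSimplex ℝ (X × Y) ×ˢ stdSimplex ℝ (X × Y)
  have hS : IsCompact S :=
    isCompact_Icc.prod ((isCompact_stdSimplex ℝ _).prod (isCompact_stdSimplex ℝ _))
  have hF : ContinuousOn F S := by
    have h1 : ContinuousOn (fun t : ℝ × (X × Y → ℝ) × (X × Y → ℝ) => condEntropy t.2.1) S :=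
      continuousOn_condEntropy.comp (by fun_prop) fun t ht => ht.2.1
    have h2 : Continuous fun t : ℝ × (X × Y → ℝ) × (X × Y → ℝ) => entropy t.2.2 :=
      continuous_entropy.comp (by fun_prop)
    have h3 : Continuous fun t : ℝ × (X × Y → ℝ) × (X × Y → ℝ) => D t.2.1 :=
      hDc.comp (by fun_prop)
    have h4 : Continuous fun t : ℝ × (X × Y → ℝ) × (X × Y → ℝ) => D t.2.2 :=
      hDc.comp (by fun_prop)
    have h5 : ContinuousOn (fun t : ℝ × (X × Y → ℝ) × (X × Y → ℝ) =>
        t.1 * (Rx - condEntropy t.2.1) + (1 - t.1) * (Rx + Ry - entropy t.2.2)) S :=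
      (continuousOn_fst.mul (continuousOn_const.sub h1)).add
        (by fun_prop)
    exact ContinuousOn.add (by fun_prop) (continuousOn_const.sup h5)
  have hne : S.Nonempty := ⟨(0, p, p), by simp, hp, hp⟩
  obtain ⟨⟨γ, q, r⟩, ⟨hγ, hq, hr⟩, hmin⟩ := hS.exists_isMinOn hne hF
  dsimp only at hγ hq hr
  have hpos : 0 < F (γ, q, r) := by
    have h0 : 0 ≤ γ := hγ.1
    have h1 : 0 ≤ 1 - γ := sub_nonneg.2 hγ.2
    have ha := mul_nonneg h0 (hD q)
    have hb := mul_nonneg h1 (hD r)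
    have hc := le_max_left 0 (γ * (Rx - condEntropy q) + (1 - γ) * (Rx + Ry - entropy r))
    -- At a zero all three terms vanish; so `q` and `r` equal `p` wherever their weights are
    -- nonzero, and the rate conditions make the last term positive.
    by_contra hle
    have hle' : γ * D q + (1 - γ) * D r
      + max 0 (γ * (Rx - condEntropy q) + (1 - γ) * (Rx + Ry - entropy r)) ≤ 0 := not_lt.1 hle
    have hq0 : γ * D q = 0 := by linarith
    have hr0 : (1 - γ) * D r = 0 := by linarith
    have hm := le_max_right 0 (γ * (Rx - condEntropy q) + (1 - γ) * (Rx + Ry - entropy r))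
    have h5 : γ * (Rx - condEntropy q) + (1 - γ) * (Rx + Ry - entropy r) ≤ 0 := by linarith
    have h6 : γ * (Rx - condEntropy q) = γ * (Rx - condEntropy p) := by
      rcases mul_eq_zero.1 hq0 with h | h
      · simp [h]
      · rw [eq_of_hellinger_eq_zero hq.1 hp.1 h]
    have h7 : (1 - γ) * (Rx + Ry - entropy r) = (1 - γ) * (Rx + Ry - entropy p) := by
      rcases mul_eq_zero.1 hr0 with h | h
      · simp [h]
      · rw [eq_of_hellinger_eq_zero hr.1 hp.1 h]
    rw [h6, h7] at h5
    rcases h0.eq_or_lt with h | h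
    · rw [← h] at h5
      linarith
    · nlinarith [mul_pos h (sub_pos.2 hx), mul_nonneg h1 (sub_pos.2 hxy).le]
  refine ⟨_, hpos, fun γ' hγ' => le_iInf₂ fun q' hq' => le_iInf₂ fun r' hr' => ?_⟩
  have hγ1 : 0 ≤ 1 - γ' := sub_nonneg.2 hγ'.2
  have h := hmin (show (γ', q', r') ∈ S from ⟨hγ', hq', hr'⟩)
  refine (ENNReal.ofReal_le_ofReal h).trans (ENNReal.ofReal_add_le.trans (add_le_add
    (ENNReal.ofReal_add_le.trans (add_le_add ?_ ?_)) ?_))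
  · rw [ENNReal.ofReal_mul hγ'.1]
    exact mul_le_mul_right (ofReal_hellinger_le_kl hq' hp) _
  · rw [ENNReal.ofReal_mul hγ1]
    exact mul_le_mul_right (ofReal_hellinger_le_kl hr' hp) _
  · simp [ENNReal.ofReal_max]

end Positivity

/-! ### Summation over the divergence times -/

theorem exists_pow_mul_pow_le (d : ℕ) {r : ℝ} (h0 : 0 < r) (h1 : r < 1) :
    ∃ c : ℝ, 0 < c ∧ ∀ m : ℕ, ((m : ℝ) + 1) ^ d * r ^ m ≤ c := by
  have h := tendsto_pow_const_mul_const_pow_of_abs_lt_one d (abs_lt.2 ⟨by linarith, h1⟩)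
  obtain ⟨c, hc⟩ := h.bddAbove_range
  refine ⟨max c 1 / r, by positivity, fun m => ?_⟩
  rw [le_div_iff₀ h0]
  refine le_trans (le_of_eq ?_) ((hc ⟨m + 1, rfl⟩).trans (le_max_left c 1))
  push_cast
  ring

theorem sum_pow_sub_le {r : ℝ} (h0 : 0 ≤ r) (h1 : r < 1) (n : ℕ) :
    ∑ k ∈ Finset.range (n + 1), r ^ (n - k) ≤ (1 - r)⁻¹ := by
  rw [Finset.sum_flip (fun k => r ^ k), ← tsum_geometric_of_lt_one h0 h1]
  exact (summable_geometric_of_lt_one h0 h1).sum_le_tsum _ fun i _ => pow_nonneg h0 i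

/-- If the summand at `(l, k)` decays exponentially in `n - l` at rate `E'` and at some positive
rate in `n - min l k`, then the sum over `l < n - Δ` decays at each rate `E < E'`. -/
theorem exists_sum_le {Q : ℕ → ℕ → ℕ → ℝ} {d : ℕ} {a E E' e : ℝ} (ha : 0 ≤ a) (hE : 0 ≤ E)
    (hEE' : E < E') (he : 0 < e)
    (h1 : ∀ n l k, l < n → k ≤ n →
      Q n l k ≤ a * ((n - min l k : ℕ) + 1 : ℝ) ^ d * (2 : ℝ) ^ (-(((n : ℝ) - l) * E')))
    (h2 : ∀ n l k, l < n → k ≤ n →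
      Q n l k ≤ a * ((n - min l k : ℕ) + 1 : ℝ) ^ d * (2 : ℝ) ^ (-((n - min l k : ℕ) * e))) :
    ∃ K : ℝ, 0 < K ∧ ∀ n Δ : ℕ, ∑ l ∈ Finset.range (n - Δ), ∑ k ∈ Finset.range (n + 1), Q n l k
      ≤ K * (2 : ℝ) ^ (-((Δ : ℝ) * E)) := by
  have hE' : 0 < E' := hE.trans_lt hEE'
  -- `s` is the weight of the second bound, chosen so that the first still contributes exactly `E`.
  obtain ⟨s, hs0, hs1, hsE⟩ : ∃ s : ℝ, 0 < s ∧ s ≤ 1 ∧ (1 - s) * E' = E :=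
    ⟨1 - E / E', sub_pos.2 ((div_lt_one hE').2 hEE'), by linarith [div_nonneg hE hE'.le],
      by field_simp; ring⟩
  -- The second bound supplies `r ^ (4 * m)`: half absorbs the polynomial, and the other half
  -- becomes geometric decay in both `n - l` and `n - k`.
  set r : ℝ := (2 : ℝ) ^ (-(s * e / 4)) with hr
  have hr0 : 0 < r := Real.rpow_pos_of_pos two_pos _
  have hr1 : r < 1 := Real.rpow_lt_one_of_one_lt_of_neg one_lt_two
    (neg_lt_zero.2 (by positivity))
  obtain ⟨c, hc0, hc⟩ := exists_pow_mul_pow_le d (pow_pos hr0 2) (pow_lt_one₀ hr0.le hr1 two_ne_zero)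
  have hQ : ∀ n Δ l k : ℕ, l < n - Δ → k ≤ n →
      Q n l k ≤ (a * c * (2 : ℝ) ^ (-((Δ : ℝ) * E))) * (r ^ (n - l) * r ^ (n - k)) := by
    intro n Δ l k hl hk
    set m := n - min l k with hm
    have hmm : (n - l) + (n - k) ≤ 2 * m := by omega
    have hln : l < n := by omega
    have hΔ : (Δ : ℝ) ≤ (n : ℝ) - l := by
      have : Δ + l ≤ n := by omega
      have : (Δ : ℝ) + l ≤ n := by exact_mod_cast this
      linarith
    -- The larger of the two exponents is at least their average with weights `1 - s` and `s`.
    have h3 : Q n l k ≤ a * ((m : ℝ) + 1) ^ d *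
        (2 : ℝ) ^ (-((1 - s) * (((n : ℝ) - l) * E') + s * (m * e))) := by
      rcases le_total (((n : ℝ) - l) * E') (m * e) with h | h
      · refine (h2 n l k hln hk).trans (mul_le_mul_of_nonneg_left
          (Real.rpow_le_rpow_of_exponent_le one_le_two ?_) (by positivity))
        nlinarith
      · refine (h1 n l k hln hk).trans (mul_le_mul_of_nonneg_left
          (Real.rpow_le_rpow_of_exponent_le one_le_two ?_) (by positivity))
        nlinarith
    have h4 : (2 : ℝ) ^ (-((1 - s) * (((n : ℝ) - l) * E') + s * (m * e)))
        ≤ (2 : ℝ) ^ (-((Δ : ℝ) * E)) * ((r ^ 2) ^ m * r ^ (2 * m)) := by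
      have hrm : (r ^ 2) ^ m * r ^ (2 * m) = (2 : ℝ) ^ (-(s * (m * e))) := by
        rw [← pow_mul, ← pow_add, hr, ← Real.rpow_natCast, ← Real.rpow_mul zero_le_two]
        congr 1
        push_cast
        ring
      rw [hrm, ← Real.rpow_add two_pos]
      refine Real.rpow_le_rpow_of_exponent_le one_le_two ?_
      have h5 := mul_le_mul_of_nonneg_right hΔ hE
      have h6 : (1 - s) * (((n : ℝ) - l) * E') = ((n : ℝ) - l) * E := by rw [← hsE]; ring
      linarith
    calc Q n l k ≤ a * ((m : ℝ) + 1) ^ d * ((2 : ℝ) ^ (-((Δ : ℝ) * E)) *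
          ((r ^ 2) ^ m * r ^ (2 * m))) :=
          h3.trans (mul_le_mul_of_nonneg_left h4 (by positivity))
      _ = a * (2 : ℝ) ^ (-((Δ : ℝ) * E)) *
          ((((m : ℝ) + 1) ^ d * (r ^ 2) ^ m) * r ^ (2 * m)) := by ring
      _ ≤ a * (2 : ℝ) ^ (-((Δ : ℝ) * E)) * (c * r ^ ((n - l) + (n - k))) := by
          refine mul_le_mul_of_nonneg_left (mul_le_mul (hc m)
            (pow_le_pow_of_le_one hr0.le hr1.le hmm) (by positivity) hc0.le) (by positivity)
      _ = _ := by rw [pow_add]; ring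
  have hg : 0 < (1 - r)⁻¹ := inv_pos.2 (sub_pos.2 hr1)
  -- The added `1` keeps the constant positive when `a = 0`.
  refine ⟨a * c * ((1 - r)⁻¹ * (1 - r)⁻¹) + 1, by positivity, fun n Δ => ?_⟩
  calc _ ≤ ∑ l ∈ Finset.range (n - Δ), ∑ k ∈ Finset.range (n + 1),
        (a * c * (2 : ℝ) ^ (-((Δ : ℝ) * E))) * (r ^ (n - l) * r ^ (n - k)) :=
        Finset.sum_le_sum fun l hl => Finset.sum_le_sum fun k hk =>
          hQ n Δ l k (Finset.mem_range.1 hl) (Nat.le_of_lt_succ (Finset.mem_range.1 hk))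
    _ = (a * c * (2 : ℝ) ^ (-((Δ : ℝ) * E))) * ((∑ l ∈ Finset.range (n - Δ), r ^ (n - l)) *
          ∑ k ∈ Finset.range (n + 1), r ^ (n - k)) := by
        rw [Finset.sum_mul_sum]
        simp only [Finset.mul_sum]
    _ ≤ (a * c * (2 : ℝ) ^ (-((Δ : ℝ) * E))) * ((1 - r)⁻¹ * (1 - r)⁻¹) := by
        refine mul_le_mul_of_nonneg_left (mul_le_mul ?_ (sum_pow_sub_le hr0.le hr1 n)
          (Finset.sum_nonneg fun _ _ => pow_nonneg hr0.le _) hg.le) (by positivity)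
        refine le_trans (Finset.sum_le_sum_of_subset_of_nonneg
          (Finset.range_subset_range.2 (by omega)) fun _ _ _ => pow_nonneg hr0.le _)
          (sum_pow_sub_le hr0.le hr1 n)
    _ ≤ _ := by
        have := Real.rpow_pos_of_pos two_pos (-((Δ : ℝ) * E))
        nlinarith

/-! ### Error exponents of weighted suffix entropy decoding -/

theorem ofReal_mul_le_of_le_inv_mul {γ E : ℝ} {b : ℝ≥0∞} (hγ : γ < 1)
    (h : ENNReal.ofReal E ≤ (ENNReal.ofReal (1 - γ))⁻¹ * b) :
    ENNReal.ofReal ((1 - γ) * E) ≤ b := by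
  have h0 : 0 < 1 - γ := sub_pos.2 hγ
  rw [ENNReal.ofReal_mul h0.le]
  refine (mul_le_mul_right h _).trans (le_of_eq ?_)
  rw [← mul_assoc, ENNReal.mul_inv_cancel (ENNReal.ofReal_pos.2 h0).ne' ENNReal.ofReal_ne_top,
    one_mul]

section Exponents

variable {X Y : Type*} [Fintype X] [Fintype Y] (p : X × Y → ℝ) (Rx Ry : ℝ)

theorem le_inv_ofReal_mul {γ : ℝ} (hγ : 0 ≤ γ) (b : ℝ≥0∞) :
    b ≤ (ENNReal.ofReal (1 - γ))⁻¹ * b := by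
  refine le_mul_of_one_le_left zero_le (ENNReal.one_le_inv.2 ?_)
  rw [← ENNReal.ofReal_one]
  exact ENNReal.ofReal_le_ofReal (by linarith)

theorem expSWXY_le_expSWX : expSWXY p Rx Ry ≤ expSWX p Rx Ry :=
  min_le_min le_rfl (iInf₂_mono fun _ hγ => le_inv_ofReal_mul hγ.1 _)

theorem expSWXY_le_expSWY : expSWXY p Rx Ry ≤ expSWY p Rx Ry :=
  min_le_min (iInf₂_mono fun _ hγ => le_inv_ofReal_mul hγ.1 _) le_rfl

end Exponents

theorem div_mem_Icc {n l k : ℕ} (hlk : l ≤ k) (hkn : k ≤ n) (hl : l < n) :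
    ((k : ℝ) - l) / ((n : ℝ) - l) ∈ Set.Icc (0 : ℝ) 1 := by
  have h1 : (l : ℝ) ≤ k := by exact_mod_cast hlk
  have h2 : (k : ℝ) ≤ n := by exact_mod_cast hkn
  have h3 : (l : ℝ) < n := by exact_mod_cast hl
  exact ⟨div_nonneg (by linarith) (by linarith), div_le_one_of_le₀ (by linarith) (by linarith)⟩

/-- Here `1 - γ` is the share of the suffix after the later divergence, so it rescales an exponent
from the earlier to the later divergence time. -/
theorem div_lt_one_and_mul {n l k : ℕ} (hkn : k < n) (hl : l < n) (E : ℝ) :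
    ((k : ℝ) - l) / ((n : ℝ) - l) < 1 ∧
      ((n : ℝ) - l) * ((1 - ((k : ℝ) - l) / ((n : ℝ) - l)) * E) = ((n : ℝ) - k) * E := by
  have h2 : (k : ℝ) < n := by exact_mod_cast hkn
  have h3 : (0 : ℝ) < (n : ℝ) - l := sub_pos.2 (by exact_mod_cast hl)
  refine ⟨(div_lt_one h3).2 (by linarith), ?_⟩
  field_simp
  ring

/-- The gap between `E` and `E'` is what the final summation spends. -/
theorem exists_real_gt_of_lt {E : ℝ} (hE : 0 ≤ E) {b : ℝ≥0∞} (h : (E : EReal) < (b : EReal)) :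
    ∃ E' : ℝ, E < E' ∧ ENNReal.ofReal E' ≤ b := by
  obtain ⟨E', h1, h2⟩ := EReal.lt_iff_exists_real_btwn.1 h
  have hEE' : E < E' := EReal.coe_lt_coe_iff.1 h1
  refine ⟨E', hEE', ?_⟩
  have : ((ENNReal.ofReal E' : ℝ≥0∞) : EReal) = (E' : EReal) := by
    rw [EReal.coe_ennreal_ofReal, max_eq_left (hE.trans hEE'.le)]
  rw [← EReal.coe_ennreal_le_coe_ennreal_iff, this]
  exact h2.le

namespace SequentialCode

variable {X : Type*} {Y : Type*} [Fintype X] [Fintype Y] {Rx Ry : ℝ}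
  {C : SequentialCode X Y Rx Ry} {p : X × Y → ℝ}

/-- The rate conditions enter here: they give some positive decay rate measured from the earlier
divergence, whichever source diverges first. -/
theorem exists_confusionProb_le (hC : C.IsRandomBinning) (hp : p ∈ stdSimplex ℝ (X × Y))
    (hx : condEntropy p < Rx) (hy : condEntropy (swapped p) < Ry) (hxy : entropy p < Rx + Ry) :
    ∃ e : ℝ, 0 < e ∧ ∀ n l k, k ≤ n → l ≤ n → min l k < n → C.confusionProb p n l k
      ≤ 4 * ((n - min l k : ℕ) + 1 : ℝ) ^ (4 * Fintype.card (X × Y))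
        * (2 : ℝ) ^ (-((n - min l k : ℕ) * e)) := by
  obtain ⟨e₁, he₁, h₁⟩ := exists_pos_le_expX hp hx hxy
  obtain ⟨e₂, he₂, h₂⟩ := exists_pos_le_expX (Rx := Ry) (Ry := Rx) (swapped_mem_stdSimplex hp) hy
    (by rwa [entropy_swapped, add_comm])
  simp only [← expY_eq_expX_swapped] at h₂
  refine ⟨min e₁ e₂, lt_min he₁ he₂, fun n l k hkn hln hlt => ?_⟩
  rcases le_total l k with h | h
  · rw [min_eq_left h] at hlt ⊢
    have := confusionProb_le_of_le hC hp h hkn hlt ((ENNReal.ofReal_le_ofReal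
      (min_le_left e₁ e₂)).trans (h₁ _ (div_mem_Icc h hkn hlt)))
    rwa [Nat.cast_sub hln] at this ⊢
  · rw [min_eq_right h] at hlt ⊢
    have := confusionProb_le_of_ge hC hp h hln hlt ((ENNReal.ofReal_le_ofReal
      (min_le_right e₁ e₂)).trans (h₂ _ (div_mem_Icc h hln hlt)))
    rwa [Nat.cast_sub hkn] at this ⊢

theorem exists_errX_le (hC : C.IsRandomBinning) (hD : C.IsWeightedSuffixEntropyDecoding)
    (hp : p ∈ stdSimplex ℝ (X × Y)) (hx : condEntropy p < Rx)
    (hy : condEntropy (swapped p) < Ry) (hxy : entropy p < Rx + Ry) {E : ℝ}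
    (hE : (E : EReal) < (expSWX p Rx Ry : EReal)) :
    ∃ K : ℝ, 0 < K ∧ ∀ n Δ : ℕ, C.errX p n Δ ≤ K * (2 : ℝ) ^ (-((Δ : ℝ) * E)) := by
  -- For negative `E` the claimed bound is at least one.
  rcases lt_or_ge E 0 with h0 | h0
  · refine ⟨1, one_pos, fun n Δ => (sum_source_le_one hp _).trans ?_⟩
    rw [one_mul]
    exact Real.one_le_rpow one_le_two (by nlinarith [Nat.cast_nonneg (α := ℝ) Δ])
  obtain ⟨E', hEE', hE'⟩ := exists_real_gt_of_lt h0 hE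
  obtain ⟨e, he, hcp⟩ := exists_confusionProb_le hC hp hx hy hxy
  have h1 : ∀ n l k, l < n → k ≤ n → C.confusionProb p n l k
      ≤ 4 * ((n - min l k : ℕ) + 1 : ℝ) ^ (4 * Fintype.card (X × Y))
        * (2 : ℝ) ^ (-(((n : ℝ) - l) * E')) := by
    intro n l k hl hk
    rcases le_or_gt l k with h | h
    · rw [min_eq_left h]
      exact confusionProb_le_of_le hC hp h hk hl
        ((hE'.trans (min_le_left _ _)).trans (iInf₂_le _ (div_mem_Icc h hk hl)))
    -- When `y` diverges first, the bound is in `n - k`; as `l < n` gives `γ < 1`, the factor `1 /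
    -- (1 - γ)` converts it to `n - l`.
    · have hkn := h.trans hl
      obtain ⟨h1, h2⟩ := div_lt_one_and_mul hl hkn E'
      rw [min_eq_right h.le, ← h2]
      exact confusionProb_le_of_ge hC hp h.le hl.le hkn (ofReal_mul_le_of_le_inv_mul h1
        ((hE'.trans (min_le_right _ _)).trans (iInf₂_le _ (div_mem_Icc h.le hl.le hkn))))
  obtain ⟨K, hK, h⟩ := exists_sum_le (Q := C.confusionProb p) (by norm_num) h0 hEE' he h1
    fun n l k hl hk => hcp n l k hk hl.le ((min_le_left l k).trans_lt hl)
  exact ⟨K, hK, fun n Δ => (errX_le hD hp n Δ).trans (h n Δ)⟩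

theorem exists_errY_le (hC : C.IsRandomBinning) (hD : C.IsWeightedSuffixEntropyDecoding)
    (hp : p ∈ stdSimplex ℝ (X × Y)) (hx : condEntropy p < Rx)
    (hy : condEntropy (swapped p) < Ry) (hxy : entropy p < Rx + Ry) {E : ℝ}
    (hE : (E : EReal) < (expSWY p Rx Ry : EReal)) :
    ∃ K : ℝ, 0 < K ∧ ∀ n Δ : ℕ, C.errY p n Δ ≤ K * (2 : ℝ) ^ (-((Δ : ℝ) * E)) := by
  rcases lt_or_ge E 0 with h0 | h0
  · refine ⟨1, one_pos, fun n Δ => (sum_source_le_one hp _).trans ?_⟩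
    rw [one_mul]
    exact Real.one_le_rpow one_le_two (by nlinarith [Nat.cast_nonneg (α := ℝ) Δ])
  obtain ⟨E', hEE', hE'⟩ := exists_real_gt_of_lt h0 hE
  obtain ⟨e, he, hcp⟩ := exists_confusionProb_le hC hp hx hy hxy
  have h1 : ∀ n k l, k < n → l ≤ n → C.confusionProb p n l k
      ≤ 4 * ((n - min k l : ℕ) + 1 : ℝ) ^ (4 * Fintype.card (X × Y))
        * (2 : ℝ) ^ (-(((n : ℝ) - k) * E')) := by
    intro n k l hk hl
    rcases le_or_gt k l with h | h
    · rw [min_eq_left h]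
      exact confusionProb_le_of_ge hC hp h hl hk
        ((hE'.trans (min_le_right _ _)).trans (iInf₂_le _ (div_mem_Icc h hl hk)))
    · have hln := h.trans hk
      obtain ⟨h1, h2⟩ := div_lt_one_and_mul hk hln E'
      rw [min_eq_right h.le, ← h2]
      exact confusionProb_le_of_le hC hp h.le hk.le hln (ofReal_mul_le_of_le_inv_mul h1
        ((hE'.trans (min_le_left _ _)).trans (iInf₂_le _ (div_mem_Icc h.le hk.le hln))))
  obtain ⟨K, hK, h⟩ := exists_sum_le (Q := fun n k l => C.confusionProb p n l k)
    (by norm_num) h0 hEE' he h1 fun n k l hk hl => min_comm l k ▸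
      hcp n l k hk.le hl ((min_le_right l k).trans_lt hk)
  exact ⟨K, hK, fun n Δ => (errY_le hD hp n Δ).trans (h n Δ)⟩

theorem exists_errXY_le (hC : C.IsRandomBinning) (hD : C.IsWeightedSuffixEntropyDecoding)
    (hp : p ∈ stdSimplex ℝ (X × Y)) (hx : condEntropy p < Rx)
    (hy : condEntropy (swapped p) < Ry) (hxy : entropy p < Rx + Ry) {E : ℝ}
    (hE : (E : EReal) < (expSWXY p Rx Ry : EReal)) :
    ∃ K : ℝ, 0 < K ∧ ∀ n Δ : ℕ, C.errXY p n Δ ≤ K * (2 : ℝ) ^ (-((Δ : ℝ) * E)) := by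
  obtain ⟨K₁, hK₁, h₁⟩ := exists_errX_le hC hD hp hx hy hxy (E := E)
    (hE.trans_le (EReal.coe_ennreal_le_coe_ennreal_iff.2 (expSWXY_le_expSWX p Rx Ry)))
  obtain ⟨K₂, hK₂, h₂⟩ := exists_errY_le hC hD hp hx hy hxy (E := E)
    (hE.trans_le (EReal.coe_ennreal_le_coe_ennreal_iff.2 (expSWXY_le_expSWY p Rx Ry)))
  refine ⟨K₁ + K₂, add_pos hK₁ hK₂, fun n Δ => (errXY_le hp n Δ).trans ?_⟩
  rw [add_mul]
  exact add_le_add (h₁ n Δ) (h₂ n Δ)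

end SequentialCode

/-! ### Existence of the code -/

section Existence

theorem exists_mem_winnersX {X Y : Type*} [Fintype X] [Fintype Y] {n : ℕ} {Bx : Set (Fin n → X)}
    {By : Set (Fin n → Y)} (hx : Bx.Nonempty) (hy : By.Nonempty) : (winnersX Bx By).Nonempty := by
  obtain ⟨⟨x, y⟩, ⟨hx', hy'⟩, hmax⟩ := Set.exists_max_image (Bx ×ˢ By)
    (fun z => scoreX Bx By z.1 z.2) (Set.toFinite _) (hx.prod hy)
  exact ⟨x, hx', y, hy', fun x' h1 y' h2 => hmax (x', y') ⟨h1, h2⟩⟩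

theorem exists_mem_winnersY {X Y : Type*} [Fintype X] [Fintype Y] {n : ℕ} {Bx : Set (Fin n → X)}
    {By : Set (Fin n → Y)} (hx : Bx.Nonempty) (hy : By.Nonempty) : (winnersY Bx By).Nonempty :=
  winnersX_swap Bx By ▸ exists_mem_winnersX hy hx

universe u v

variable (X : Type u) (Y : Type v) (Rx Ry : ℝ)

/-- The index set of the bits of a causal binning. -/
abbrev BitIndex : Type (max u v) :=
  (Σ i : ℕ, (Fin (i + 1) → X) × Fin (bitsAt Rx i)) ⊕
    (Σ i : ℕ, (Fin (i + 1) → Y) × Fin (bitsAt Ry i))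

/-- The law of a fair bit. -/
noncomputable def fairBit : Measure Bool := (PMF.uniformOfFintype Bool).toMeasure

instance : IsProbabilityMeasure fairBit := PMF.toMeasure.isProbabilityMeasure _

theorem fairBit_true : fairBit {b | b = true} = 1 / 2 := by
  rw [fairBit, Set.ofPred_eq_eq_singleton,
    PMF.toMeasure_apply_singleton _ _ (measurableSet_singleton _), PMF.uniformOfFintype_apply]
  simp

/-- The sequences that have the given encodings under the binning `ω`. -/
def candidates (ω : BitIndex X Y Rx Ry → Bool) (n : ℕ) (a : BitStream Rx n)
    (b : BitStream Ry n) : Set (Fin n → X) × Set (Fin n → Y) :=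
  ({x | (fun i t => ω (Sum.inl ⟨i, initial x i, t⟩) : BitStream Rx n) = a},
    {y | (fun i t => ω (Sum.inr ⟨i, initial y i, t⟩) : BitStream Ry n) = b})

variable {X Y Rx Ry} in
theorem measurableSet_candidates [Fintype X] [Fintype Y] (n : ℕ) (a : BitStream Rx n) (b : BitStream Ry n)
    (B : Set (Fin n → X) × Set (Fin n → Y)) :
    MeasurableSet {ω | candidates X Y Rx Ry ω n a b = B} := by
  have h : {ω | candidates X Y Rx Ry ω n a b = B}
      = {ω | (∀ x, (∀ i t, ω (Sum.inl ⟨i, initial x i, t⟩) = a i t) ↔ x ∈ B.1) ∧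
        ∀ y, (∀ i t, ω (Sum.inr ⟨i, initial y i, t⟩) = b i t) ↔ y ∈ B.2} := by
    ext ω
    simp only [candidates, Set.mem_ofPred_eq, Prod.ext_iff, Set.ext_iff, funext_iff]
  rw [h]
  have hω : ∀ (j : BitIndex X Y Rx Ry) (c : Bool),
      Measurable fun ω : BitIndex X Y Rx Ry → Bool => ω j = c :=
    fun j c => measurableSet_setOfPred.1
      (show MeasurableSet ((fun ω : BitIndex X Y Rx Ry → Bool => ω j) ⁻¹' {c}) from
        measurable_pi_apply j (measurableSet_singleton c))
  exact measurableSet_setOfPred.2 (.and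
    (.forall fun x => .iff (.forall fun i => .forall fun t => hω _ _) measurable_const)
    (.forall fun y => .iff (.forall fun i => .forall fun t => hω _ _) measurable_const))

variable [Fintype X] [Fintype Y] [Nonempty X] [Nonempty Y]

open Classical in
/-- Some winner, if there is one. -/
noncomputable def chooseWinners {n : ℕ} (B : Set (Fin n → X) × Set (Fin n → Y)) :
    (Fin n → X) × (Fin n → Y) :=
  if h : B.1.Nonempty ∧ B.2.Nonempty then
    ((exists_mem_winnersX h.1 h.2).some, (exists_mem_winnersY h.1 h.2).some)
  -- This value is used only for streams that no source sequence produces.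
  else Classical.arbitrary _

/-- Causal random binning with weighted suffix entropy decoding. -/
noncomputable def randomBinningCode : SequentialCode X Y Rx Ry where
  Ω := BitIndex X Y Rx Ry → Bool
  μ := Measure.infinitePi fun _ => fairBit
  encX ω i x t := ω (Sum.inl ⟨i, x, t⟩)
  encY ω i y t := ω (Sum.inr ⟨i, y, t⟩)
  dec ω n a b := chooseWinners X Y (candidates X Y Rx Ry ω n a b)
  measurable_encX i x t := measurable_pi_apply _
  measurable_encY i y t := measurable_pi_apply _
  measurableSet_dec n a b z := by
    have h : {ω | chooseWinners X Y (candidates X Y Rx Ry ω n a b) = z}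
        = ⋃ B ∈ {B | chooseWinners X Y B = z}, {ω | candidates X Y Rx Ry ω n a b = B} := by
      ext ω; simp
    rw [h]
    -- The decoder sees the binning only through the candidate sets, and these take finitely many
    -- values.
    exact MeasurableSet.biUnion (Set.to_countable _) fun B _ => measurableSet_candidates n a b B

theorem isRandomBinning_randomBinningCode : (randomBinningCode X Y Rx Ry).IsRandomBinning := by
  have hbit : ∀ j : BitIndex X Y Rx Ry,
      (Measure.infinitePi fun _ : BitIndex X Y Rx Ry => fairBit) {ω | ω j = true} = 1 / 2 := by
    intro j
    have h := (measurePreserving_eval_infinitePi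
      (fun _ : BitIndex X Y Rx Ry => fairBit) j).measure_preimage
      (s := {b | b = true}) (Set.toFinite _).measurableSet.nullMeasurableSet
    exact h.trans fairBit_true
  refine ⟨?_, fun i x t => hbit _, fun i y t => hbit _⟩
  have h := iIndepFun_infinitePi (P := fun _ : BitIndex X Y Rx Ry => fairBit)
    (X := fun _ b => b) (fun _ => measurable_id)
  have hf : (fun j ω => ω j : BitIndex X Y Rx Ry → (BitIndex X Y Rx Ry → Bool) → Bool)
      = Sum.elim (fun a ω => ω (Sum.inl a)) (fun b ω => ω (Sum.inr b)) := by
    funext j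
    cases j <;> rfl
  rw [hf] at h
  exact h

theorem isWeightedSuffixEntropyDecoding_randomBinningCode :
    (randomBinningCode X Y Rx Ry).IsWeightedSuffixEntropyDecoding := by
  intro ω n a b ha hb
  have h : (randomBinningCode X Y Rx Ry).dec ω n a b
      = ((exists_mem_winnersX ha hb).some, (exists_mem_winnersY ha hb).some) :=
    dif_pos ⟨ha, hb⟩
  rw [h]
  exact ⟨(exists_mem_winnersX ha hb).some_mem, (exists_mem_winnersY ha hb).some_mem⟩

end Existence

end StreamingSW

theorem mainTheorem2 {X : Type*} {Y : Type*} [Fintype X] [Fintype Y] [Nonempty X] [Nonempty Y]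
    (Rx Ry : ℝ) :
    ∃ C : StreamingSW.SequentialCode X Y Rx Ry,
      C.IsRandomBinning ∧ C.IsWeightedSuffixEntropyDecoding ∧
      ∀ p ∈ stdSimplex ℝ (X × Y),
        StreamingSW.condEntropy p < Rx →
        StreamingSW.condEntropy (StreamingSW.swapped p) < Ry →
        StreamingSW.entropy p < Rx + Ry →
        (∀ E : ℝ, (E : EReal) < (StreamingSW.expSWX p Rx Ry : EReal) →
          ∃ K : ℝ, 0 < K ∧ ∀ n Δ : ℕ, C.errX p n Δ ≤ K * (2 : ℝ) ^ (-((Δ : ℝ) * E))) ∧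
        (∀ E : ℝ, (E : EReal) < (StreamingSW.expSWY p Rx Ry : EReal) →
          ∃ K : ℝ, 0 < K ∧ ∀ n Δ : ℕ, C.errY p n Δ ≤ K * (2 : ℝ) ^ (-((Δ : ℝ) * E))) ∧
        (∀ E : ℝ, (E : EReal) < (StreamingSW.expSWXY p Rx Ry : EReal) →
          ∃ K : ℝ, 0 < K ∧ ∀ n Δ : ℕ, C.errXY p n Δ ≤ K * (2 : ℝ) ^ (-((Δ : ℝ) * E))) := by
  have hC := StreamingSW.isRandomBinning_randomBinningCode X Y Rx Ry
  have hD := StreamingSW.isWeightedSuffixEntropyDecoding_randomBinningCode X Y Rx Ry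
  exact ⟨_, hC, hD, fun p hp hx hy hxy =>
    ⟨fun _ hE => StreamingSW.SequentialCode.exists_errX_le hC hD hp hx hy hxy hE,
      fun _ hE => StreamingSW.SequentialCode.exists_errY_le hC hD hp hx hy hxy hE,
      fun _ hE => StreamingSW.SequentialCode.exists_errXY_le hC hD hp hx hy hxy hE⟩⟩
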